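/- **Conventions.** For $K=\mathbb R,\mathbb C$ let $K(\!(\tfrac1v)\!)^c$ be the field of Laurent series $\sum_{k\ge m}a_kv^{-k}$ over $K$ ($m\in\mathbb Z$) that converge for $|v|\gg 0$. All functions of $v$ are considered as germs at $v\to+\infty$ along the positive reals. A *polynomial phase function* is a continuous real function germ $\phi$ such that $f(v)\in\mathbb R_{>0}e^{i\pi\phi(v)}$ for $v\gg0$, for some $0\ne f\in\mathbb C(\!(\tfrac1v)\!)^c$; write $\phi\prec\psi$ (resp. $\phi\preceq\psi$) if $\phi(v)<\psi(v)$ (resp. $\phi(v)\le\psi(v)$) for $v\gg0$. Let $\mathcal A$ be the heart of a bounded t-structure on a triangulated category $\mathcal D$. A *polynomial stability function* on $\mathcal A$ with respect to $(a,a+1]$, for a polynomial phase function $a$, is a group homomorphism $Z:K(\mathcal D)\to\mathbb C(\!(\tfrac1v)\!)^c$ such that for every $0\neq E\in\mathcal A$ one has $Z(E)\ne0$ and $Z(E)(v)\in\mathbb R_{>0}e^{i\pi(a(v),a(v)+1]}$ for $v\gg0$. Its phase $\phi_Z(E)$ is then determined by $Z(E)(v)\in\mathbb R_{>0}e^{i\pi\phi_Z(E)(v)}$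 for $v\gg0$ and $a\prec\phi_Z(E)\preceq a+1$. A nonzero $E\in\mathcal A$ is *$Z$-semistable* if $\phi_Z(M)\preceq\phi_Z(N)$ for every short exact sequence $0\to M\to E\to N\to0$ in $\mathcal A$ with $M,N\ne0$. A *Harder–Narasimhan (HN) filtration* of $E\in\mathcal A$ is a filtration $0=E_0\subsetneq E_1\subsetneq\dots\subsetneq E_m=E$ in $\mathcal A$ with $Z$-semistable quotients and $\phi_Z(E_1/E_0)\succ\dots\succ\phi_Z(E_m/E_{m-1})$ (for $E=0$ this means $m=0$); $Z$ has the *HN property* on $\mathcal A$ if every nonzero object of $\mathcal A$ has an HN filtration. Finally, let $T\in\mathrm{GL}(2,\mathbb R(\!(\tfrac1v)\!)^c)$ with $\det T_v>0$ for $v\gg0$, acting on $\mathbb C(\!(\tfrac1v)\!)^c=\mathbb R(\!(\tfrac1v)\!)^c\oplus i\,\mathbb R(\!(\tfrac1v)\!)^c$. A lift $v\mapsto(T_v,g_v)$ $(v\ge v_1)$ of the path $v\mapsto T_v$ to the universal cover of $\mathrm{GL}^+(2,\mathbb R)$, where $g_v:\mathbb R\to\mathbb R$ is increasing, $g_v(x+1)=g_v(x)+1$,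 and $g_v$ and $T_v$ induce the same map on $\mathbb R/2\mathbb Z=(\mathbb R^2\setminus0)/\mathbb R_{>0}$, induces a bijection $\Gamma_T$ of the set of polynomial phase functions by $(\Gamma_T\phi)(v)=g_v(\phi(v))$. **Proposition.** Assume the following (Configuration III). (a) $\Phi:\mathcal D\to\mathcal U$ and $\Psi:\mathcal U\to\mathcal D$ are exact equivalences of triangulated categories with $\Psi\Phi\cong\mathrm{id}_{\mathcal D}[-1]$ and $\Phi\Psi\cong\mathrm{id}_{\mathcal U}[-1]$. (b) $\mathcal A,\mathcal B$ are the hearts of bounded t-structures on $\mathcal D,\mathcal U$, with cohomology functors $\mathcal H^i_{\mathcal A},\mathcal H^i_{\mathcal B}$, and $\mathcal H^i_{\mathcal B}(\Phi E)=0$ for all $E\in\mathcal A$ and $i\notin\{0,1\}$. (c) $Z_{\mathcal A}:K(\mathcal D)\to\mathbb C(\!(\tfrac1v)\!)^c$ and $Z_{\mathcal B}:K(\mathcal U)\to\mathbb C(\!(\tfrac1v)\!)^c$ are polynomial stability functions on $\mathcal A,\mathcal B$ with respect to $(a,a+1]$, $(b,b+1]$, and there are $T$ as above with $Z_{\mathcal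 B}(\Phi E)=T\,Z_{\mathcal A}(E)$ for all $E\in\mathcal D$, and a choice of $\Gamma_T$ with $a\prec\Gamma_T^{-1}(b)\prec a+1$. If $Z_{\mathcal A}$ has the HN property on $\mathcal A$, then $Z_{\mathcal B}$ has the HN property on $\mathcal B$. Moreover, for every $X\in\mathcal B$ there are $M,N\in\mathcal A$ with $M\cong\mathcal H^0_{\mathcal A}(\Psi X)$, $N\cong\mathcal H^1_{\mathcal A}(\Psi X)$ and an exact triangle $$M[1]\to\Psi X[1]\to N\to M[2]$$ such that, for all HN filtrations $0=M_0\subsetneq\dots\subsetneq M_k=M$ and $0=N_0\subsetneq\dots\subsetneq N_l=N$ with respect to $Z_{\mathcal A}$, there is an HN filtration $0=X_0\subsetneq\dots\subsetneq X_{k+l}=X$ with respect to $Z_{\mathcal B}$ which, under the isomorphism $\Phi(\Psi X[1])\cong X$ given by (a), is the image under $\Phi$ of the concatenation of the two: $X_i$ is the image under $\Phi$ of $M_i[1]\to M[1]\to\Psi X[1]$ for $0\le i\le k$, and $X_{k+j}$ is the image under $\Phi$ of a morphism $\widetilde N_j\to\Psi X[1]$ lifting $N_j\to N$ for $0\le j\le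 l$, i.e. one that, together with $\mathrm{id}_{M[1]}$ and $N_j\to N$, is a morphism from an exact triangle $M[1]\to\widetilde N_j\to N_j\to M[2]$ to the triangle above. -/

import Mathlib

open CategoryTheory CategoryTheory.Limits CategoryTheory.Pretriangulated CategoryTheory.Triangulated
open Filter

noncomputable section

namespace PolyStab

universe v₁ u₁ v₂ u₂

/-! ### Convergent Laurent series

An element `∑ aₙ wⁿ` of `LaurentSeries K` is read as a series in `w = 1/v`. -/

section Laurent

variable {K : Type} [RCLike K]

/-- A formal Laurent series converges on some punctured disk `0 < |w| < R`. -/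
def IsConvergent (f : LaurentSeries K) : Prop :=
  ∃ R : ℝ, 0 < R ∧ ∀ w : K, 0 < ‖w‖ → ‖w‖ < R → Summable fun n : ℤ => f.coeff n * w ^ n

theorem isConvergent_iff (f : LaurentSeries K) :
    IsConvergent f ↔ ∃ r : ℝ, 0 < r ∧ Summable fun n : ℤ => ‖f.coeff n‖ * r ^ n := by
  constructor
  · rintro ⟨R, hR, h⟩
    refine ⟨R / 2, by positivity, ?_⟩
    have hn : ‖((R / 2 : ℝ) : K)‖ = R / 2 := by
      rw [RCLike.norm_ofReal, abs_of_pos (by positivity)]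
    have := (h ((R / 2 : ℝ) : K) (by rw [hn]; positivity) (by rw [hn]; linarith)).norm
    simpa only [norm_mul, norm_zpow, hn] using this
  · rintro ⟨r, hr, h⟩
    refine ⟨r, hr, fun w hw hwr => Summable.of_norm ?_⟩
    refine Summable.of_nonneg_of_le (fun n => norm_nonneg _) (fun n => ?_)
      (h.mul_left ((‖w‖ / r) ^ f.order))
    by_cases hn : n < f.order
    · simp [HahnSeries.coeff_eq_zero_of_lt_order hn]
    · have h1 : (‖w‖ / r) ^ n ≤ (‖w‖ / r) ^ f.order :=
        zpow_le_zpow_right_of_le_one₀ (by positivity) ((div_le_one hr).2 hwr.le) (not_lt.1 hn)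
      rw [div_zpow ‖w‖ r n, div_le_iff₀ (by positivity)] at h1
      rw [norm_mul, norm_zpow]
      calc ‖f.coeff n‖ * ‖w‖ ^ n ≤ ‖f.coeff n‖ * ((‖w‖ / r) ^ f.order * r ^ n) := by gcongr
        _ = _ := by ring

theorem summable_of_le {f : LaurentSeries K} {r s : ℝ} (hr : 0 < r) (hrs : r ≤ s)
    (h : Summable fun n : ℤ => ‖f.coeff n‖ * s ^ n) :
    Summable fun n : ℤ => ‖f.coeff n‖ * r ^ n := by
  have hs : 0 < s := hr.trans_le hrs
  refine Summable.of_nonneg_of_le (fun n => by positivity) (fun n => ?_)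
    (h.mul_left ((r / s) ^ f.order))
  by_cases hn : n < f.order
  · simp [HahnSeries.coeff_eq_zero_of_lt_order hn]
  · have h1 : (r / s) ^ n ≤ (r / s) ^ f.order :=
      zpow_le_zpow_right_of_le_one₀ (by positivity) ((div_le_one hs).2 hrs) (not_lt.1 hn)
    rw [div_zpow r s n, div_le_iff₀ (by positivity)] at h1
    calc ‖f.coeff n‖ * r ^ n ≤ ‖f.coeff n‖ * ((r / s) ^ f.order * s ^ n) := by gcongr
      _ = _ := by ring

theorem isConvergent_of_norm_coeff_le {L : Type} [RCLike L] {f g : LaurentSeries K}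
    {h : LaurentSeries L} (hf : IsConvergent f) (hg : IsConvergent g)
    (hle : ∀ n, ‖h.coeff n‖ ≤ ‖f.coeff n‖ + ‖g.coeff n‖) : IsConvergent h := by
  rw [isConvergent_iff] at hf hg ⊢
  obtain ⟨r, hr, hf⟩ := hf
  obtain ⟨s, hs, hg⟩ := hg
  have hm : 0 < min r s := lt_min hr hs
  refine ⟨min r s, hm, Summable.of_nonneg_of_le (fun n => by positivity) (fun n => ?_)
    ((summable_of_le hm (min_le_left _ _) hf).add (summable_of_le hm (min_le_right _ _) hg))⟩
  rw [← add_mul]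
  exact mul_le_mul_of_nonneg_right (hle n) (by positivity)

theorem IsConvergent.mul {f g : LaurentSeries K} (hf : IsConvergent f) (hg : IsConvergent g) :
    IsConvergent (f * g) := by
  rw [isConvergent_iff] at hf hg ⊢
  obtain ⟨r, hr, hf⟩ := hf
  obtain ⟨s, hs, hg⟩ := hg
  have hm : 0 < min r s := lt_min hr hs
  set m := min r s
  have hf' := summable_of_le hm (min_le_left _ _) hf
  have hg' := summable_of_le hm (min_le_right _ _) hg
  have hfg := hf'.mul_of_nonneg hg' (fun n => by positivity) (fun n => by positivity)
  let e : ℤ × ℤ ≃ ℤ × ℤ :=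
    { toFun := fun p => (p.2, p.1 - p.2)
      invFun := fun p => (p.1 + p.2, p.1)
      left_inv := fun p => by ext <;> simp
      right_inv := fun p => by ext <;> simp }
  have h2 := (e.summable_iff).2 hfg
  have h3 : Summable fun n : ℤ => ∑' i : ℤ, ‖f.coeff i‖ * ‖g.coeff (n - i)‖ * m ^ n := by
    refine h2.prod.congr fun n => tsum_congr fun i => ?_
    simp only [e, Function.comp, Equiv.coe_fn_mk]
    have : m ^ n = m ^ i * m ^ (n - i) := by rw [← zpow_add₀ hm.ne']; congr 1; ring
    rw [this]; ring
  refine ⟨m, hm, Summable.of_nonneg_of_le (fun n => by positivity) (fun n => ?_) h3⟩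
  have h4 : Summable fun i : ℤ => ‖f.coeff i‖ * ‖g.coeff (n - i)‖ * m ^ n := by
    refine (h2.prod_factor n).congr fun i => ?_
    simp only [e, Function.comp, Equiv.coe_fn_mk]
    have : m ^ n = m ^ i * m ^ (n - i) := by rw [← zpow_add₀ hm.ne']; congr 1; ring
    rw [this]; ring
  rw [HahnSeries.coeff_mul]
  set A := Finset.addAntidiagonal f.isPWO_support g.isPWO_support n
  have hinj : Set.InjOn Prod.fst (A : Set (ℤ × ℤ)) := by
    intro p hp q hq hpq
    have hp' := (Finset.mem_addAntidiagonal.1 (Finset.mem_coe.1 hp)).2.2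
    have hq' := (Finset.mem_addAntidiagonal.1 (Finset.mem_coe.1 hq)).2.2
    ext
    · exact hpq
    · have : p.1 = q.1 := hpq
      omega
  calc ‖∑ p ∈ A, f.coeff p.1 * g.coeff p.2‖ * m ^ n
      ≤ (∑ p ∈ A, ‖f.coeff p.1‖ * ‖g.coeff p.2‖) * m ^ n := by
        gcongr
        refine (norm_sum_le _ _).trans (Finset.sum_le_sum fun p _ => (norm_mul_le _ _))
    _ = ∑ p ∈ A, ‖f.coeff p.1‖ * ‖g.coeff (n - p.1)‖ * m ^ n := by
        rw [Finset.sum_mul]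
        refine Finset.sum_congr rfl fun p hp => ?_
        have hp' := (Finset.mem_addAntidiagonal.1 hp).2.2
        rw [show n - p.1 = p.2 by omega]
    _ = ∑ i ∈ A.image Prod.fst, ‖f.coeff i‖ * ‖g.coeff (n - i)‖ * m ^ n := by
        rw [Finset.sum_image hinj]
    _ ≤ _ := h4.sum_le_tsum _ (fun i _ => by positivity)

theorem isConvergent_single (k : ℤ) (a : K) :
    IsConvergent (HahnSeries.single k a : LaurentSeries K) := by
  refine ⟨1, one_pos, fun w _ _ => ?_⟩
  refine summable_of_ne_finset_zero (s := {k}) fun n hn => ?_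
  rw [HahnSeries.coeff_single_of_ne (by simpa using hn), zero_mul]

variable (K) in
/-- The ring `K((w))ᶜ` of convergent Laurent series. -/
def convergentLaurent : Subring (LaurentSeries K) where
  carrier := {f | IsConvergent f}
  mul_mem' := fun hf hg => hf.mul hg
  one_mem' := isConvergent_single 0 1
  add_mem' := fun {f g} hf hg => isConvergent_of_norm_coeff_le hf hg fun n => by
    simpa using norm_add_le (f.coeff n) (g.coeff n)
  zero_mem' := by
    have := isConvergent_single (K := K) 0 0
    rwa [HahnSeries.single_eq_zero] at this
  neg_mem' := fun {f} hf => isConvergent_of_norm_coeff_le hf hf fun n => by simp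

/-- The value at the real number `v` of a Laurent series in `1/v`. -/
def evalAt (f : LaurentSeries K) (v : ℝ) : K :=
  ∑' n : ℤ, f.coeff n * ((v : K)⁻¹) ^ n

end Laurent

/-- The field `ℂ((1/v))ᶜ`. -/
abbrev CLaurent : Type := convergentLaurent ℂ

/-- The field `ℝ((1/v))ᶜ`. -/
abbrev RLaurent : Type := convergentLaurent ℝ

/-- The real part of a series, taken coefficientwise. -/
def rePart (f : CLaurent) : RLaurent :=
  ⟨HahnSeries.map f.1 Complex.reAddGroupHom,
    isConvergent_of_norm_coeff_le f.2 f.2 fun n => by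
      have h1 : ‖(f.1.coeff n).re‖ ≤ ‖f.1.coeff n‖ := Complex.abs_re_le_norm _
      have h2 := norm_nonneg (f.1.coeff n)
      simp only [HahnSeries.map_coeff, Complex.coe_reAddGroupHom]
      linarith⟩

/-- The imaginary part of a series, taken coefficientwise. -/
def imPart (f : CLaurent) : RLaurent :=
  ⟨HahnSeries.map f.1 Complex.imAddGroupHom,
    isConvergent_of_norm_coeff_le f.2 f.2 fun n => by
      have h1 : ‖(f.1.coeff n).im‖ ≤ ‖f.1.coeff n‖ := Complex.abs_im_le_norm _
      have h2 := norm_nonneg (f.1.coeff n)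
      simp only [HahnSeries.map_coeff, Complex.coe_imAddGroupHom]
      linarith⟩

/-- The series `x + i y` for real series `x`, `y`. -/
def ofReIm (x y : RLaurent) : CLaurent :=
  ⟨HahnSeries.map x.1 Complex.ofRealHom +
      HahnSeries.single 0 Complex.I * HahnSeries.map y.1 Complex.ofRealHom,
    (convergentLaurent ℂ).add_mem
      (isConvergent_of_norm_coeff_le x.2 x.2 fun n => by simp)
      ((convergentLaurent ℂ).mul_mem (isConvergent_single 0 Complex.I)
        (isConvergent_of_norm_coeff_le y.2 y.2 fun n => by simp))⟩

/-! ### Matrices of real series and their action on complex series -/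

/-- The real matrix `T_v`, the value of `T` at `v`. -/
def matrixAt (T : GL (Fin 2) RLaurent) (v : ℝ) : Matrix (Fin 2) (Fin 2) ℝ :=
  Matrix.of fun i j => evalAt ((T : Matrix (Fin 2) (Fin 2) RLaurent) i j).1 v

/-- `T_v` has positive determinant for `v ≫ 0`. -/
def IsOrientationPreserving (T : GL (Fin 2) RLaurent) : Prop :=
  ∀ᶠ v in atTop, 0 < (matrixAt T v).det

/-- The action of `T` on `ℂ((1/v))ᶜ = ℝ((1/v))ᶜ ⊕ i ℝ((1/v))ᶜ`. -/
def act (T : GL (Fin 2) RLaurent) (f : CLaurent) : CLaurent :=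
  ofReIm
    ((T : Matrix (Fin 2) (Fin 2) RLaurent) 0 0 * rePart f +
      (T : Matrix (Fin 2) (Fin 2) RLaurent) 0 1 * imPart f)
    ((T : Matrix (Fin 2) (Fin 2) RLaurent) 1 0 * rePart f +
      (T : Matrix (Fin 2) (Fin 2) RLaurent) 1 1 * imPart f)

/-- A lift `v ↦ (T_v, g_v)`, `v ≥ v₁`, of the path `v ↦ T_v` in `GL⁺(2,ℝ)` to its universal cover,
whose points over a matrix `M` are the increasing bijections `g` of `ℝ` with `g (x+1) = g x + 1`
that induce on `ℝ/2ℤ = (ℝ² ∖ 0)/ℝ_{>0}` the same map as `M`. Continuity of the lift is continuity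
of `v ↦ g_v x` for every `x`. -/
structure LiftedPath (T : GL (Fin 2) RLaurent) where
  /-- the starting point of the path -/
  v₁ : ℝ
  v₁_pos : 0 < v₁
  /-- the maps `g_v` -/
  g : ℝ → (ℝ ≃o ℝ)
  det_pos : ∀ v, v₁ ≤ v → 0 < (matrixAt T v).det
  g_add_one : ∀ v, v₁ ≤ v → ∀ x, g v (x + 1) = g v x + 1
  compat : ∀ v, v₁ ≤ v → ∀ x, ∃ r : ℝ, 0 < r ∧
    (matrixAt T v).mulVec ![Real.cos (Real.pi * x), Real.sin (Real.pi * x)] =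
      r • ![Real.cos (Real.pi * g v x), Real.sin (Real.pi * g v x)]
  continuousOn : ∀ x, ContinuousOn (fun v => g v x) (Set.Ici v₁)

/-- The map `Γ_T` on phase functions attached to a lifted path. -/
def LiftedPath.Gamma {T : GL (Fin 2) RLaurent} (p : LiftedPath T) (φ : ℝ → ℝ) : ℝ → ℝ :=
  fun v => p.g v (φ v)

/-- The inverse of `Γ_T`. -/
def LiftedPath.GammaInv {T : GL (Fin 2) RLaurent} (p : LiftedPath T) (φ : ℝ → ℝ) : ℝ → ℝ :=
  fun v => (p.g v).symm (φ v)

theorem LiftedPath.GammaInv_Gamma {T : GL (Fin 2) RLaurent} (p : LiftedPath T) (φ : ℝ → ℝ) :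
    p.GammaInv (p.Gamma φ) = φ := by
  funext v; simp [Gamma, GammaInv]

theorem LiftedPath.Gamma_GammaInv {T : GL (Fin 2) RLaurent} (p : LiftedPath T) (φ : ℝ → ℝ) :
    p.Gamma (p.GammaInv φ) = φ := by
  funext v; simp [Gamma, GammaInv]

/-! ### Phase functions

Function germs at `v → ∞` are represented by functions `ℝ → ℝ`; every notion below depends only
on the germ. -/

/-- `f(v) ∈ ℝ_{>0} e^{iπφ(v)}` for `v ≫ 0`. -/
def HasPhase (f : CLaurent) (φ : ℝ → ℝ) : Prop :=
  ∀ᶠ v in atTop, ∃ r : ℝ, 0 < r ∧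
    evalAt f.1 v = (r : ℂ) * Complex.exp (Complex.I * ((Real.pi * φ v : ℝ) : ℂ))

/-- Polynomial phase functions: continuous germs that are a phase of a nonzero series. -/
def IsPolyPhase (φ : ℝ → ℝ) : Prop :=
  ∃ f : CLaurent, f ≠ 0 ∧ (∃ v₀ : ℝ, ContinuousOn φ (Set.Ioi v₀)) ∧ HasPhase f φ

/-- The relation `φ ≺ ψ`. -/
def PhaseLT (φ ψ : ℝ → ℝ) : Prop := ∀ᶠ v in atTop, φ v < ψ v

/-- The relation `φ ≼ ψ`. -/
def PhaseLE (φ ψ : ℝ → ℝ) : Prop := ∀ᶠ v in atTop, φ v ≤ ψ v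

open Classical in
/-- The phase function, in the range `(φ₀, φ₀ + 1]`, of a series `f` with values in
`ℝ_{≥0} e^{iπ(φ₀, φ₀ + 1]}` for `v ≫ 0`: it is `φ₀ + 1` if `f = 0`, and otherwise the representative
in `(φ₀, φ₀ + 2]`, modulo `2`, of `arg (f v) / π`, which then lies in `(φ₀, φ₀ + 1]`. -/
def phaseOf (φ₀ : ℝ → ℝ) (f : CLaurent) : ℝ → ℝ := fun v =>
  if f = 0 then φ₀ v + 1 else toIocMod two_pos (φ₀ v) (Complex.arg (evalAt f.1 v) / Real.pi)

/-- `phaseOf` is the function singled out by the defining relations of the phase. -/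
theorem phaseOf_eventuallyEq {φ₀ φ : ℝ → ℝ} {f : CLaurent} (hf : f ≠ 0) (h : HasPhase f φ)
    (h₀ : PhaseLT φ₀ φ) (h₁ : PhaseLE φ (fun v => φ₀ v + 1)) : phaseOf φ₀ f =ᶠ[atTop] φ := by
  filter_upwards [h, h₀, h₁] with v hv h0 h1
  obtain ⟨r, hr, hv⟩ := hv
  simp only [phaseOf, if_neg hf]
  rw [toIocMod_eq_iff]
  refine ⟨⟨h0, by linarith⟩, -toIocDiv Real.two_pi_pos (-Real.pi) (Real.pi * φ v), ?_⟩
  rw [hv, mul_comm Complex.I, Complex.exp_mul_I, Complex.arg_mul_cos_add_sin_mul_I_eq_toIocMod hr,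
    toIocMod]
  have := Real.pi_ne_zero
  simp only [zsmul_eq_mul, Int.cast_neg]
  field_simp
  ring

/-! ### The Grothendieck group of a triangulated category -/

section Category

variable (C : Type u₁) [Category.{v₁} C] [Preadditive C] [HasZeroObject C] [HasShift C ℤ]
  [∀ n : ℤ, (shiftFunctor C n).Additive] [Pretriangulated C]

/-- The relations `[Y] = [X] + [Z]` for all distinguished triangles `X ⟶ Y ⟶ Z ⟶ X⟦1⟧`. -/
def K₀Relations : AddSubgroup (FreeAbelianGroup C) :=
  AddSubgroup.closure {x | ∃ T : Triangle C, T ∈ distTriang C ∧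
    x = FreeAbelianGroup.of T.obj₂ - FreeAbelianGroup.of T.obj₁ - FreeAbelianGroup.of T.obj₃}

/-- The Grothendieck group `K(C)`. -/
abbrev K₀ : Type u₁ := FreeAbelianGroup C ⧸ K₀Relations C

variable {C}

/-- The class `[E]` in `K(C)`. -/
def K₀.of (E : C) : K₀ C := QuotientAddGroup.mk (FreeAbelianGroup.of E)

/-! ### t-structures and hearts -/

/-- Every object is bounded for the t-structure. -/
def IsBounded (t : TStructure C) : Prop := ∀ X : C, t.bounded X

/-- The heart, as a full subcategory. -/
abbrev HeartCat (t : TStructure C) : Type u₁ := t.heart.FullSubcategory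

/-- The cohomology object `Hⁿ(X) = (τ_{≤ n} τ_{≥ n} X)[n]`. -/
def cohomology (t : TStructure C) (n : ℤ) (X : C) : C :=
  ((t.truncLE n).obj ((t.truncGE n).obj X))⟦n⟧

/-- The subcategory `D^{[a,b]}`. -/
def IsInRange (t : TStructure C) (a b : ℤ) (X : C) : Prop :=
  ∀ n : ℤ, n ∉ Set.Icc a b → IsZero (cohomology t n X)

/-! ### Stability -/

/-- The value `Z(E)` of a group homomorphism on `K(C)` at an object. -/
def charge (Z : K₀ C →+ CLaurent) (E : C) : CLaurent := Z (K₀.of E)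

/-- `Z` is a weak polynomial stability function on the heart of `t` with respect to
`(φ₀, φ₀ + 1]`. -/
def IsWeakPolyStabilityFunction (t : TStructure C) (φ₀ : ℝ → ℝ) (Z : K₀ C →+ CLaurent) : Prop :=
  IsPolyPhase φ₀ ∧ ∀ E : HeartCat t, ¬ IsZero E → ∀ᶠ v in atTop,
    ∃ r θ : ℝ, 0 ≤ r ∧ θ ∈ Set.Ioc (φ₀ v) (φ₀ v + 1) ∧
      evalAt (charge Z E.obj).1 v = (r : ℂ) * Complex.exp (Complex.I * ((Real.pi * θ : ℝ) : ℂ))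

/-- `Z` is a polynomial stability function on the heart of `t` with respect to `(φ₀, φ₀ + 1]`. -/
def IsPolyStabilityFunction (t : TStructure C) (φ₀ : ℝ → ℝ) (Z : K₀ C →+ CLaurent) : Prop :=
  IsWeakPolyStabilityFunction t φ₀ Z ∧ ∀ E : HeartCat t, ¬ IsZero E → charge Z E.obj ≠ 0

variable (t : TStructure C) (φ₀ : ℝ → ℝ) (Z : K₀ C →+ CLaurent)

/-- The phase function `φ_Z(E)`. -/
def phase (E : C) : ℝ → ℝ := phaseOf φ₀ (charge Z E)

/-- `E` is a `Z`-semistable object of the heart. -/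
def IsSemistable (E : HeartCat t) : Prop :=
  ¬ IsZero E ∧ ∀ (M N : HeartCat t) (i : M ⟶ E) (p : E ⟶ N) (w : i ≫ p = 0),
    (ShortComplex.mk i p w).ShortExact → ¬ IsZero M → ¬ IsZero N →
      PhaseLE (phase φ₀ Z M.obj) (phase φ₀ Z N.obj)

/-- `0 = F₀ ⊊ F₁ ⊊ ⋯ ⊊ Fₘ = E` is a Harder–Narasimhan filtration of `E` in the heart: there are
quotients `Qᵢ = Fᵢ₊₁/Fᵢ` which are semistable, with strictly decreasing phases. For `m = 0` this
says that `E` is zero. -/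
def IsHNFiltration {E : HeartCat t} {m : ℕ} (F : Fin (m + 1) → Subobject E) : Prop :=
  ∃ hF : StrictMono F, IsZero (F 0 : HeartCat t) ∧ F (Fin.last m) = ⊤ ∧
    ∃ (Q : Fin m → HeartCat t) (π : ∀ i : Fin m, (F i.succ : HeartCat t) ⟶ Q i)
      (w : ∀ i : Fin m,
        Subobject.ofLE (F i.castSucc) (F i.succ) (hF i.castSucc_lt_succ).le ≫ π i = 0),
      (∀ i, (ShortComplex.mk _ (π i) (w i)).ShortExact) ∧
      (∀ i, IsSemistable t φ₀ Z (Q i)) ∧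
      ∀ i j, i < j → PhaseLT (phase φ₀ Z (Q j).obj) (phase φ₀ Z (Q i).obj)

/-- The Harder–Narasimhan property of `Z` on the heart of `t`. -/
def HasHNProperty : Prop :=
  ∀ E : HeartCat t, ¬ IsZero E →
    ∃ m : ℕ, 1 ≤ m ∧ ∃ F : Fin (m + 1) → Subobject E, IsHNFiltration t φ₀ Z F

end Category

/-! ### Transport of filtrations along the equivalences -/

section Transport

variable {D : Type u₁} [Category.{v₁} D] [Preadditive D] [HasZeroObject D] [HasShift D ℤ]
  [∀ n : ℤ, (shiftFunctor D n).Additive] [Pretriangulated D]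
  {U : Type u₂} [Category.{v₂} U] [Preadditive U] [HasZeroObject U] [HasShift U ℤ]
  [∀ n : ℤ, (shiftFunctor U n).Additive] [Pretriangulated U]
  (Φ : D ⥤ U) [Φ.CommShift ℤ] (Ψ : U ⥤ D) (β : Ψ ⋙ Φ ≅ shiftFunctor U (-1 : ℤ))

/-- The isomorphism `Φ(ΨX[1]) ≅ X` induced by `ΦΨ ≅ id[-1]`. -/
def reflectIso (X : U) : Φ.obj ((Ψ.obj X)⟦(1 : ℤ)⟧) ≅ X :=
  (Φ.commShiftIso (1 : ℤ)).app (Ψ.obj X) ≪≫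
    (shiftFunctor U (1 : ℤ)).mapIso (β.app X) ≪≫
    (shiftFunctorCompIsoId U (-1 : ℤ) 1 (by norm_num)).app X

/-- The subobject `S` of `X` in the heart is the image under `Φ` of the morphism `n : L ⟶ ΨX[1]`:
under `Φ(ΨX[1]) ≅ X`, the inclusion of `S` becomes `Φ n`. -/
def IsImageOf (t : TStructure U) {X : HeartCat t} (S : Subobject X) {L : D}
    (n : L ⟶ (Ψ.obj X.obj)⟦(1 : ℤ)⟧) : Prop :=
  ∃ e : (S : HeartCat t).obj ≅ Φ.obj L,
    e.hom ≫ Φ.map n ≫ (reflectIso Φ Ψ β X.obj).hom = t.heart.ι.map S.arrow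

/-- Let `M[1] ⟶ ΨX[1] ⟶ N ⟶ M[2]` (with maps `u`, `p`, `w`) be a distinguished triangle with `M`, `N`
in the heart of `tA`. The filtration `FX` of `X` is the image under `Φ` of the concatenation of the
filtrations `FM` of `M` and `FN` of `N`:
* for `i ≤ k`, `(FX)ᵢ` is the image of `(FM)ᵢ[1] ⟶ M[1] ⟶ ΨX[1]`;
* for `j ≤ l`, `(FX)ₖ₊ⱼ` is the image of a lift `L` of `(FN)ⱼ` along `p`, that is, of a morphism
  `L ⟶ ΨX[1]` which together with `(FN)ⱼ ⟶ N` and the identity of `M[1]` is a morphism from a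
  distinguished triangle `M[1] ⟶ L ⟶ (FN)ⱼ ⟶ M[2]` to the given one. -/
def IsImageOfConcatenation (tA : TStructure D) (tB : TStructure U) {X : HeartCat tB}
    {M N : HeartCat tA} (u : M.obj⟦(1 : ℤ)⟧ ⟶ (Ψ.obj X.obj)⟦(1 : ℤ)⟧)
    (p : (Ψ.obj X.obj)⟦(1 : ℤ)⟧ ⟶ N.obj) (w : N.obj ⟶ (M.obj⟦(1 : ℤ)⟧)⟦(1 : ℤ)⟧)
    {k l : ℕ} (FM : Fin (k + 1) → Subobject M) (FN : Fin (l + 1) → Subobject N)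
    (FX : Fin (k + l + 1) → Subobject X) : Prop :=
  (∀ i : Fin (k + 1), IsImageOf Φ Ψ β tB (FX ⟨i, by omega⟩)
    ((tA.heart.ι.map (FM i).arrow)⟦(1 : ℤ)⟧' ≫ u)) ∧
  ∀ j : Fin (l + 1), ∃ (L : D) (n : L ⟶ (Ψ.obj X.obj)⟦(1 : ℤ)⟧) (x : M.obj⟦(1 : ℤ)⟧ ⟶ L)
    (y : L ⟶ (FN j : HeartCat tA).obj)
    (z : (FN j : HeartCat tA).obj ⟶ (M.obj⟦(1 : ℤ)⟧)⟦(1 : ℤ)⟧),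
    Triangle.mk x y z ∈ distTriang D ∧ x ≫ n = u ∧ n ≫ p = y ≫ tA.heart.ι.map (FN j).arrow ∧
      z = tA.heart.ι.map (FN j).arrow ≫ w ∧ IsImageOf Φ Ψ β tB (FX ⟨k + j, by omega⟩) n

end Transport

end PolyStab

end

open PolyStab

/-! Pull the t-structure of $\mathcal B$ back to $\mathcal D$ along $\Phi$ (`transport`) and let
$\mathcal B'$ be its heart. Condition (b) says that $\mathcal A$ has amplitude $[0,1]$ for the new
t-structure, so $\mathcal B'$ is a tilt of $\mathcal A$. With the torsion class $\mathcal T=\mathcal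
A\cap\mathcal B'$ and the torsion-free class $\mathcal F=\mathcal A\cap\mathcal B'[-1]$, every
object of $\mathcal A$ is an extension of an object of $\mathcal F$ by one of $\mathcal T$. Every
$X\in\mathcal B'$ sits in a triangle $K[1]\to X\to R$ with $K\in\mathcal F$, $R\in\mathcal T$
(`IsTilt.exists_torsion_triangle`, `IsTilt.exists_torsion_triangle'`).

The charges make this torsion pair a cut at one phase. Since $\Gamma_T^{-1}(b)$ lies strictly
between $a$ and $a+1$, nonzero objects of $\mathcal T$ have $Z_{\mathcal A}$-phase
$\succ\Gamma_T^{-1}(b)$ and those of $\mathcal F$ have phase $\preceq\Gamma_T^{-1}(b)$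
(`StabilityTilt.phase_torsion`, `StabilityTilt.phase_torsionFree`). Hence the torsion sequence would
destabilize a semistable object outside both classes, and every semistable object of $\mathcal A$
lies in $\mathcal T$ or in $\mathcal F$.

Semistability survives the tilt: if $E$ is semistable in $\mathcal A$, then $E$ (for $E\in\mathcal
T$) or $E[1]$ (for $E\in\mathcal F$) is semistable in $\mathcal B'$. A short exact sequence in
$\mathcal B'$ is compared, through the octahedral axiom, with one in $\mathcal A$; the difference of
the charges comes from an object of the other class, and the cut gives it the favourable sign
(`StabilityTilt.nonnegCross_of_torsion`, `StabilityTilt.nonnegCross_of_torsionFree`).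

For $X\in\mathcal B$ the triangle of $\Psi X[1]$ has $M\in\mathcal F$ and $N\in\mathcal T$, and all
their HN factors stay in the same class. So $\Phi(-[1])$ and $\Phi$ carry the two HN filtrations to
HN filtrations in $\mathcal B$, and the cut puts every phase coming from $M$ above every phase
coming from $N$. The concatenation is therefore an HN filtration of $X$
(`StabilityTilt.exists_concatenation`).

Phases are compared throughout by the sign of the cross product $\mathrm{Im}(\bar z w)$ of charges.
This sign is additive enough for triangles and invariant under matrices of positive determinant. -/

namespace PolyStab

/-! ### Values of convergent Laurent series -/

section Evaluation

variable {K : Type} [RCLike K]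

theorem norm_coeff_mul_inv_zpow (f : LaurentSeries K) {v : ℝ} (hv : 0 < v) (n : ℤ) :
    ‖f.coeff n * ((v : K)⁻¹) ^ n‖ = ‖f.coeff n‖ * (v⁻¹) ^ n := by
  rw [norm_mul, norm_zpow, norm_inv, RCLike.norm_ofReal, abs_of_pos hv]

theorem IsConvergent.eventually_summable {f : LaurentSeries K} (hf : IsConvergent f) :
    ∀ᶠ v : ℝ in atTop, Summable fun n : ℤ => ‖f.coeff n * ((v : K)⁻¹) ^ n‖ := by
  rw [isConvergent_iff] at hf
  obtain ⟨r, hr, h⟩ := hf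
  filter_upwards [eventually_gt_atTop 0, eventually_ge_atTop r⁻¹] with v hv hvr
  simp only [norm_coeff_mul_inv_zpow f hv]
  exact summable_of_le (inv_pos.2 hv) (inv_le_of_inv_le₀ hr hvr) h

theorem IsConvergent.evalAt_add {f g : LaurentSeries K} (hf : IsConvergent f)
    (hg : IsConvergent g) : ∀ᶠ v in atTop, evalAt (f + g) v = evalAt f v + evalAt g v := by
  filter_upwards [hf.eventually_summable, hg.eventually_summable] with v h1 h2
  rw [evalAt, evalAt, evalAt, ← h1.of_norm.tsum_add h2.of_norm]
  simp [add_mul]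

theorem evalAt_neg (f : LaurentSeries K) (v : ℝ) : evalAt (-f) v = -evalAt f v := by
  simp [evalAt, tsum_neg]

theorem evalAt_zero (v : ℝ) : evalAt (0 : LaurentSeries K) v = 0 := by
  simp [evalAt]

/-- The bijection `(n, i) ↦ (i, n - i)`. -/
def splitSum : ℤ × ℤ ≃ ℤ × ℤ where
  toFun p := (p.2, p.1 - p.2)
  invFun p := (p.1 + p.2, p.1)
  left_inv p := by ext <;> simp
  right_inv p := by ext <;> simp

theorem splitSum_apply (p : ℤ × ℤ) : splitSum p = (p.2, p.1 - p.2) := rfl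

theorem tsum_coeff_mul_zpow {f g : LaurentSeries K} {w : K} (hw : w ≠ 0)
    (h1 : Summable fun n : ℤ => ‖f.coeff n * w ^ n‖)
    (h2 : Summable fun n : ℤ => ‖g.coeff n * w ^ n‖) :
    ∑' n : ℤ, (f * g).coeff n * w ^ n =
      (∑' n : ℤ, f.coeff n * w ^ n) * ∑' n : ℤ, g.coeff n * w ^ n := by
  have hs := summable_mul_of_summable_norm h1 h2
  have hs' := splitSum.summable_iff.2 hs
  simp only [Function.comp_def] at hs'
  rw [tsum_mul_tsum_of_summable_norm h1 h2, ← splitSum.tsum_eq, hs'.tsum_prod]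
  simp only [splitSum_apply]
  refine tsum_congr fun n => ?_
  rw [HahnSeries.coeff_mul, Finset.sum_mul]
  have hmem : ∀ p ∈ Finset.antidiagonal f.isPWO_support g.isPWO_support n, p.1 + p.2 = n :=
    fun p hp => (Finset.mem_antidiagonal.1 hp).2.2
  have hinj : Set.InjOn Prod.fst
      (Finset.antidiagonal f.isPWO_support g.isPWO_support n : Set (ℤ × ℤ)) := by
    intro p hp q hq hpq
    have hp' := hmem p hp
    have hq' := hmem q hq
    exact Prod.ext hpq (by omega)
  -- For fixed `n` only finitely many `i` contribute: those with `(i, n - i)` in the antidiagonal of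
  -- the supports.
  rw [tsum_eq_sum (s := (Finset.antidiagonal f.isPWO_support g.isPWO_support n).image Prod.fst),
    Finset.sum_image hinj]
  · refine Finset.sum_congr rfl fun p hp => ?_
    have hp' := hmem p hp
    rw [show n - p.1 = p.2 by omega, ← hp', zpow_add₀ hw]
    ring
  · intro i hi
    by_contra hne
    refine hi (Finset.mem_image.2 ⟨(i, n - i), Finset.mem_antidiagonal.2 ⟨?_, ?_, by simp⟩, rfl⟩)
    · intro h0; simp [h0] at hne
    · intro h0; simp [h0] at hne

theorem IsConvergent.evalAt_mul {f g : LaurentSeries K} (hf : IsConvergent f)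
    (hg : IsConvergent g) : ∀ᶠ v in atTop, evalAt (f * g) v = evalAt f v * evalAt g v := by
  filter_upwards [hf.eventually_summable, hg.eventually_summable, eventually_gt_atTop 0]
    with v h1 h2 hv
  exact tsum_coeff_mul_zpow (inv_ne_zero (by exact_mod_cast hv.ne')) h1 h2

/-- The leading term dominates. If the value vanished at `v`, the leading term would be minus the
tail, which is at most `(v⁻¹ / r) ^ (m + 1) * S`. Dividing by `v⁻¹ ^ m` bounds the nonzero leading
coefficient by a constant times `v⁻¹`, which fails for large `v`. -/
theorem IsConvergent.eventually_evalAt_ne_zero {f : LaurentSeries K} (hf : IsConvergent f)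
    (h0 : f ≠ 0) : ∀ᶠ v in atTop, evalAt f v ≠ 0 := by
  have hconv := hf
  rw [isConvergent_iff] at hf
  obtain ⟨r, hr, h⟩ := hf
  set m := f.order
  have hm : f.coeff m ≠ 0 := HahnSeries.coeff_order_eq_zero.not.2 h0
  set S := ∑' n : ℤ, ‖f.coeff n‖ * r ^ n
  have hlim : Tendsto (fun v : ℝ => v⁻¹ * (S / r ^ (m + 1))) atTop (nhds 0) := by
    simpa using tendsto_inv_atTop_zero.mul_const (S / r ^ (m + 1))
  filter_upwards [eventually_gt_atTop 0, eventually_ge_atTop r⁻¹,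
    hlim.eventually (gt_mem_nhds (norm_pos_iff.2 hm)), hconv.eventually_summable]
    with v hv hvr hlt hsum h00
  have hw : v⁻¹ ≤ r := inv_le_of_inv_le₀ hr hvr
  have hw0 : 0 < v⁻¹ := inv_pos.2 hv
  rw [evalAt, hsum.of_norm.tsum_eq_add_tsum_ite m] at h00
  have hle : ∀ n : ℤ, ‖(if n = m then (0 : K) else f.coeff n * ((v : K)⁻¹) ^ n)‖ ≤
      (v⁻¹ / r) ^ (m + 1) * (‖f.coeff n‖ * r ^ n) := by
    intro n
    split_ifs with hn
    · rw [norm_zero]; positivity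
    · rw [norm_coeff_mul_inv_zpow f hv]
      rcases lt_or_gt_of_ne hn with hn | hn
      · simp [HahnSeries.coeff_eq_zero_of_lt_order hn]
      · have h1 : (v⁻¹ / r) ^ n ≤ (v⁻¹ / r) ^ (m + 1) :=
          zpow_le_zpow_right_of_le_one₀ (by positivity) ((div_le_one hr).2 hw) (by omega)
        rw [div_zpow v⁻¹ r n, div_le_iff₀ (by positivity)] at h1
        calc ‖f.coeff n‖ * v⁻¹ ^ n ≤ ‖f.coeff n‖ * ((v⁻¹ / r) ^ (m + 1) * r ^ n) := by gcongr
          _ = _ := by ring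
  have h5 := tsum_of_norm_bounded (h.hasSum.mul_left ((v⁻¹ / r) ^ (m + 1))) hle
  rw [← neg_eq_of_add_eq_zero_right h00, norm_neg, norm_coeff_mul_inv_zpow f hv] at h5
  have h6 : ‖f.coeff m‖ ≤ v⁻¹ * (S / r ^ (m + 1)) := by
    have h7 : 0 < v⁻¹ ^ m := by positivity
    refine le_of_mul_le_mul_right (h5.trans_eq ?_) h7
    rw [div_zpow, zpow_add_one₀ hw0.ne']
    ring
  exact absurd h6 (not_le.2 hlt)

end Evaluation

/-! ### Values of real and imaginary parts and of the matrix action. -/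

theorem evalAt_rePart (f : CLaurent) :
    ∀ᶠ v in atTop, evalAt (rePart f).1 v = (evalAt f.1 v).re := by
  filter_upwards [IsConvergent.eventually_summable f.2] with v h
  rw [evalAt, evalAt, Complex.re_tsum h.of_norm]
  refine tsum_congr fun n => ?_
  have : ((v : ℂ)⁻¹) ^ n = (((v⁻¹) ^ n : ℝ) : ℂ) := by push_cast; rfl
  change (f.1.coeff n).re * (v⁻¹) ^ n = _
  exact (congrArg Complex.re (congrArg (f.1.coeff n * ·) this)).trans
    (Complex.re_mul_ofReal _ _) |>.symm

theorem evalAt_imPart (f : CLaurent) :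
    ∀ᶠ v in atTop, evalAt (imPart f).1 v = (evalAt f.1 v).im := by
  filter_upwards [IsConvergent.eventually_summable f.2] with v h
  rw [evalAt, evalAt, Complex.im_tsum h.of_norm]
  refine tsum_congr fun n => ?_
  have : ((v : ℂ)⁻¹) ^ n = (((v⁻¹) ^ n : ℝ) : ℂ) := by push_cast; rfl
  change (f.1.coeff n).im * (v⁻¹) ^ n = _
  exact (congrArg Complex.im (congrArg (f.1.coeff n * ·) this)).trans
    (Complex.im_mul_ofReal _ _) |>.symm

theorem evalAt_ofReIm (x y : RLaurent) :
    ∀ᶠ v in atTop, evalAt (ofReIm x y).1 v = ⟨evalAt x.1 v, evalAt y.1 v⟩ := by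
  filter_upwards [IsConvergent.eventually_summable x.2, IsConvergent.eventually_summable y.2]
    with v h1 h2
  have h1' : HasSum (fun n : ℤ => ((x.1.coeff n * (v⁻¹) ^ n : ℝ) : ℂ)) (evalAt x.1 v : ℝ) :=
    Complex.hasSum_ofReal.2 h1.of_norm.hasSum
  have h2' : HasSum (fun n : ℤ => ((y.1.coeff n * (v⁻¹) ^ n : ℝ) : ℂ)) (evalAt y.1 v : ℝ) :=
    Complex.hasSum_ofReal.2 h2.of_norm.hasSum
  have h3 := (h1'.add (h2'.mul_left Complex.I)).tsum_eq
  have h4 : evalAt (ofReIm x y).1 v = (evalAt x.1 v : ℝ) + Complex.I * (evalAt y.1 v : ℝ) := by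
    rw [← h3, evalAt]
    refine tsum_congr fun n => ?_
    have h5 : (ofReIm x y).1.coeff n = (x.1.coeff n : ℂ) + Complex.I * (y.1.coeff n : ℂ) := by
      simp [ofReIm]
    rw [h5]
    have h6 : ((RCLike.ofReal v : ℂ)⁻¹) ^ n = (((v⁻¹) ^ n : ℝ) : ℂ) := by push_cast; rfl
    rw [h6]
    push_cast
    ring
  rw [h4]
  apply Complex.ext <;> simp

theorem evalAt_act (T : GL (Fin 2) RLaurent) (f : CLaurent) :
    ∀ᶠ v in atTop, evalAt (act T f).1 v =
      ⟨matrixAt T v 0 0 * (evalAt f.1 v).re + matrixAt T v 0 1 * (evalAt f.1 v).im,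
        matrixAt T v 1 0 * (evalAt f.1 v).re + matrixAt T v 1 1 * (evalAt f.1 v).im⟩ := by
  have key : ∀ x y : RLaurent, ∀ᶠ v in atTop,
      evalAt (x * rePart f + y * imPart f).1 v =
        evalAt x.1 v * (evalAt f.1 v).re + evalAt y.1 v * (evalAt f.1 v).im := by
    intro x y
    filter_upwards [IsConvergent.evalAt_mul x.2 (rePart f).2,
      IsConvergent.evalAt_mul y.2 (imPart f).2,
      IsConvergent.evalAt_add (x * rePart f).2 (y * imPart f).2,
      evalAt_rePart f, evalAt_imPart f] with v h1 h2 h3 h4 h5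
    rw [← h4, ← h5, ← h1, ← h2]
    exact h3
  filter_upwards [key ((T : Matrix (Fin 2) (Fin 2) RLaurent) 0 0)
      ((T : Matrix (Fin 2) (Fin 2) RLaurent) 0 1),
    key ((T : Matrix (Fin 2) (Fin 2) RLaurent) 1 0) ((T : Matrix (Fin 2) (Fin 2) RLaurent) 1 1),
    evalAt_ofReIm ((T : Matrix (Fin 2) (Fin 2) RLaurent) 0 0 * rePart f +
        (T : Matrix (Fin 2) (Fin 2) RLaurent) 0 1 * imPart f)
      ((T : Matrix (Fin 2) (Fin 2) RLaurent) 1 0 * rePart f +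
        (T : Matrix (Fin 2) (Fin 2) RLaurent) 1 1 * imPart f)] with v h1 h2 h3
  rw [act, h3, h1, h2]
  rfl


/-! ### Comparison of phases by cross products -/

/-- The oriented area `Re z Im w - Im z Re w`. -/
def cross (z w : ℂ) : ℝ := z.re * w.im - z.im * w.re

theorem cross_self (z : ℂ) : cross z z = 0 := by simp only [cross]; ring

theorem cross_swap (z w : ℂ) : cross z w = -cross w z := by simp only [cross]; ring

theorem cross_add_left (z z' w : ℂ) : cross (z + z') w = cross z w + cross z' w := by
  simp only [cross, Complex.add_re, Complex.add_im]; ring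

theorem cross_add_right (z w w' : ℂ) : cross z (w + w') = cross z w + cross z w' := by
  simp only [cross, Complex.add_re, Complex.add_im]; ring

theorem cross_neg_left (z w : ℂ) : cross (-z) w = -cross z w := by
  simp only [cross, Complex.neg_re, Complex.neg_im]; ring

theorem cross_neg_right (z w : ℂ) : cross z (-w) = -cross z w := by
  simp only [cross, Complex.neg_re, Complex.neg_im]; ring

/-- The complex number `r e^{iπθ}`. -/
noncomputable def polar (r θ : ℝ) : ℂ := (r : ℂ) * Complex.exp (Complex.I * ((Real.pi * θ : ℝ) : ℂ))

theorem polar_re (r θ : ℝ) : (polar r θ).re = r * Real.cos (Real.pi * θ) := by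
  rw [polar, mul_comm Complex.I, Complex.re_ofReal_mul, Complex.exp_ofReal_mul_I_re]

theorem polar_im (r θ : ℝ) : (polar r θ).im = r * Real.sin (Real.pi * θ) := by
  rw [polar, mul_comm Complex.I, Complex.im_ofReal_mul, Complex.exp_ofReal_mul_I_im]

theorem cross_polar (r r' θ θ' : ℝ) :
    cross (polar r θ) (polar r' θ') = r * r' * Real.sin (Real.pi * (θ' - θ)) := by
  rw [cross, polar_re, polar_im, polar_re, polar_im, mul_sub, Real.sin_sub]
  ring

theorem sin_pi_mul_pos {x : ℝ} (h0 : 0 < x) (h1 : x < 1) : 0 < Real.sin (Real.pi * x) :=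
  Real.sin_pos_of_pos_of_lt_pi (mul_pos Real.pi_pos h0) (by nlinarith [Real.pi_pos])

theorem cross_polar_pos {r r' θ θ' : ℝ} (hr : 0 < r) (hr' : 0 < r') (h : θ < θ')
    (h1 : θ' < θ + 1) : 0 < cross (polar r θ) (polar r' θ') := by
  rw [cross_polar]
  exact mul_pos (mul_pos hr hr') (sin_pi_mul_pos (by linarith) (by linarith))

/-- The cross product is a positive multiple of $\sin\pi(\theta'-\theta)$, whose sign is that of
$\theta'-\theta$ as long as $|\theta'-\theta|<1$. Two phases in the same window $(a,a+1]$ always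
satisfy this. -/
theorem cross_polar_pos_iff {r r' θ θ' : ℝ} (hr : 0 < r) (hr' : 0 < r') (h : θ < θ' + 1)
    (h' : θ' < θ + 1) : 0 < cross (polar r θ) (polar r' θ') ↔ θ < θ' := by
  refine ⟨fun hc => ?_, fun hlt => cross_polar_pos hr hr' hlt h'⟩
  by_contra hle
  rcases (not_lt.1 hle).eq_or_lt with he | hlt
  · rw [cross_polar, he] at hc
    simp at hc
  · have := cross_polar_pos hr' hr hlt h
    rw [cross_swap] at hc
    linarith

theorem cross_polar_nonneg_iff {r r' θ θ' : ℝ} (hr : 0 < r) (hr' : 0 < r') (h : θ < θ' + 1)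
    (h' : θ' < θ + 1) : 0 ≤ cross (polar r θ) (polar r' θ') ↔ θ ≤ θ' := by
  have := cross_polar_pos_iff hr' hr h' h
  rw [cross_swap, neg_nonneg, ← not_lt, ← not_lt, this]

theorem eq_add_two_mul_of_polar_eq {r s x y : ℝ} (hr : 0 < r) (hs : 0 < s)
    (h : polar r x = polar s y) : ∃ n : ℤ, x = y + 2 * n := by
  have hn : ∀ {r x : ℝ}, 0 < r → ‖polar r x‖ = r := by
    intro r x hr
    rw [polar, mul_comm Complex.I, norm_mul, Complex.norm_exp_ofReal_mul_I, mul_one,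
      Complex.norm_real, Real.norm_of_nonneg hr.le]
  have hrs : r = s := by rw [← hn hr (x := x), h, hn hs]
  subst hrs
  have h2 := mul_left_cancel₀ (Complex.ofReal_ne_zero.2 hr.ne') h
  obtain ⟨n, hn⟩ := Complex.exp_eq_exp_iff_exists_int.1 h2
  refine ⟨n, ?_⟩
  have h3 := congrArg Complex.im hn
  simp at h3
  have := Real.pi_pos
  refine mul_left_cancel₀ this.ne' ?_
  linarith

/-- `Im (conj f · g) ≥ 0` for `v ≫ 0`. -/
def NonnegCross (f g : CLaurent) : Prop :=
  ∀ᶠ v in atTop, 0 ≤ cross (evalAt f.1 v) (evalAt g.1 v)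

/-- `Im (conj f · g) > 0` for `v ≫ 0`. -/
def PosCross (f g : CLaurent) : Prop :=
  ∀ᶠ v in atTop, 0 < cross (evalAt f.1 v) (evalAt g.1 v)

theorem PosCross.nonneg {f g : CLaurent} (h : PosCross f g) : NonnegCross f g :=
  h.mono fun _ => le_of_lt

theorem evalAt_add_charge (f g : CLaurent) :
    ∀ᶠ v in atTop, evalAt (f + g).1 v = evalAt f.1 v + evalAt g.1 v :=
  IsConvergent.evalAt_add f.2 g.2

theorem evalAt_neg_charge (f : CLaurent) (v : ℝ) : evalAt (-f).1 v = -evalAt f.1 v :=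
  evalAt_neg f.1 v

theorem nonnegCross_zero_left (f : CLaurent) : NonnegCross 0 f :=
  Eventually.of_forall fun v => by
    rw [show evalAt (0 : CLaurent).1 v = 0 from evalAt_zero v]; simp [cross]

theorem nonnegCross_self (f : CLaurent) : NonnegCross f f :=
  Eventually.of_forall fun v => by rw [cross_self]

theorem NonnegCross.add_left {f f' g : CLaurent} (h : NonnegCross f g) (h' : NonnegCross f' g) :
    NonnegCross (f + f') g := by
  filter_upwards [h, h', evalAt_add_charge f f'] with v h h' h1
  rw [h1, cross_add_left]
  exact add_nonneg h h'

theorem NonnegCross.not_posCross {f g : CLaurent} (h : NonnegCross f g) : ¬ PosCross g f := by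
  intro h'
  obtain ⟨v, h1, h2⟩ := (h.and h').exists
  rw [cross_swap] at h2
  linarith

theorem PosCross.not_posCross {f g : CLaurent} (h : PosCross f g) : ¬ PosCross g f :=
  h.nonneg.not_posCross

theorem nonnegCross_neg_neg {f g : CLaurent} : NonnegCross (-f) (-g) ↔ NonnegCross f g := by
  simp only [NonnegCross, evalAt_neg_charge, cross_neg_left, cross_neg_right, neg_neg]

theorem posCross_neg_neg {f g : CLaurent} : PosCross (-f) (-g) ↔ PosCross f g := by
  simp only [PosCross, evalAt_neg_charge, cross_neg_left, cross_neg_right, neg_neg]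

theorem nonnegCross_neg_right {f g : CLaurent} : NonnegCross f (-g) ↔ NonnegCross g f := by
  simp only [NonnegCross, evalAt_neg_charge, cross_neg_right, ← cross_swap]

theorem posCross_neg_right {f g : CLaurent} : PosCross f (-g) ↔ PosCross g f := by
  simp only [PosCross, evalAt_neg_charge, cross_neg_right, ← cross_swap]

/-- The cross product with a sum is determined by the cross product of the summands. -/
theorem nonnegCross_add_right_self {f g : CLaurent} : NonnegCross f (f + g) ↔ NonnegCross f g := by
  refine eventually_congr ?_
  filter_upwards [evalAt_add_charge f g] with v h
  rw [h, cross_add_right, cross_self, zero_add]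

theorem cross_evalAt_act (T : GL (Fin 2) RLaurent) (f g : CLaurent) :
    ∀ᶠ v in atTop, cross (evalAt (act T f).1 v) (evalAt (act T g).1 v) =
      (matrixAt T v).det * cross (evalAt f.1 v) (evalAt g.1 v) := by
  filter_upwards [evalAt_act T f, evalAt_act T g] with v h1 h2
  rw [h1, h2, Matrix.det_fin_two]
  simp only [cross]
  ring

theorem nonnegCross_act {T : GL (Fin 2) RLaurent} (hT : IsOrientationPreserving T)
    {f g : CLaurent} : NonnegCross (act T f) (act T g) ↔ NonnegCross f g := by
  refine eventually_congr ?_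
  filter_upwards [cross_evalAt_act T f g, hT] with v h h0
  rw [h, mul_nonneg_iff_of_pos_left h0]

theorem posCross_act {T : GL (Fin 2) RLaurent} (hT : IsOrientationPreserving T)
    {f g : CLaurent} : PosCross (act T f) (act T g) ↔ PosCross f g := by
  refine eventually_congr ?_
  filter_upwards [cross_evalAt_act T f g, hT] with v h h0
  rw [h, mul_pos_iff_of_pos_left h0]

section Category

open scoped ZeroObject

variable {C : Type*} [Category* C] [Preadditive C] [HasZeroObject C] [HasShift C ℤ]
  [∀ n : ℤ, (shiftFunctor C n).Additive] [Pretriangulated C]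

theorem distTriang_of_iso {X Y W X' Y' W' : C} {f : X ⟶ Y} {g : Y ⟶ W} {h : W ⟶ X⟦(1 : ℤ)⟧}
    {f' : X' ⟶ Y'} {g' : Y' ⟶ W'} {h' : W' ⟶ X'⟦(1 : ℤ)⟧}
    (hT : Triangle.mk f g h ∈ distTriang C) (e₁ : X' ≅ X) (e₂ : Y' ≅ Y) (e₃ : W' ≅ W)
    (c₁ : f' ≫ e₂.hom = e₁.hom ≫ f) (c₂ : g' ≫ e₃.hom = e₂.hom ≫ g)
    (c₃ : h' ≫ e₁.hom⟦(1 : ℤ)⟧' = e₃.hom ≫ h) : Triangle.mk f' g' h' ∈ distTriang C :=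
  isomorphic_distinguished _ hT _ (Triangle.isoMk _ _ e₁ e₂ e₃ c₁ c₂ c₃)

/-! ### Additivity of the central charge -/

theorem charge_obj₂ (Z : K₀ C →+ CLaurent) (T : Triangle C) (hT : T ∈ distTriang C) :
    charge Z T.obj₂ = charge Z T.obj₁ + charge Z T.obj₃ := by
  have h : (K₀.of T.obj₂ : K₀ C) = K₀.of T.obj₁ + K₀.of T.obj₃ := by
    rw [← sub_eq_zero, ← sub_sub]
    exact (QuotientAddGroup.eq_zero_iff _).2 (AddSubgroup.subset_closure ⟨T, hT, rfl⟩)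
  rw [charge, h, map_add]
  rfl

theorem charge_of_triangle (Z : K₀ C →+ CLaurent) {X Y W : C} {f : X ⟶ Y} {g : Y ⟶ W}
    {h : W ⟶ X⟦(1 : ℤ)⟧} (hT : Triangle.mk f g h ∈ distTriang C) :
    charge Z Y = charge Z X + charge Z W :=
  charge_obj₂ Z _ hT

theorem charge_of_isZero (Z : K₀ C →+ CLaurent) {X : C} (hX : IsZero X) : charge Z X = 0 := by
  have h := charge_of_triangle Z (contractible_distinguished X)
  have h0 := charge_of_triangle Z (contractible_distinguished (0 : C))
  have h1 : charge Z (0 : C) = 0 := by simpa using h0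
  -- Because $X$ is zero, $X\to0\to0$ is isomorphic to the contractible triangle on $0$, so
  -- $[0]=[X]+[0]$.
  have hT : Triangle.mk (0 : X ⟶ 0) (0 : (0 : C) ⟶ 0) (0 : (0 : C) ⟶ X⟦(1 : ℤ)⟧) ∈
      distTriang C := by
    refine isomorphic_distinguished _ (contractible_distinguished (0 : C)) _ ?_
    exact Triangle.isoMk _ _ (hX.iso (isZero_zero C)) (Iso.refl _) (Iso.refl _)
      ((isZero_zero C).eq_of_tgt _ _) ((isZero_zero C).eq_of_src _ _)
      ((isZero_zero C).eq_of_src _ _)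
  have h2 := charge_of_triangle Z hT
  rw [h1, add_zero] at h2
  exact h2.symm

theorem charge_of_iso (Z : K₀ C →+ CLaurent) {X Y : C} (e : X ≅ Y) : charge Z X = charge Z Y := by
  have hT : Triangle.mk e.hom (0 : Y ⟶ 0) (0 : (0 : C) ⟶ X⟦(1 : ℤ)⟧) ∈ distTriang C := by
    exact distTriang_of_iso (contractible_distinguished X) (Iso.refl X) e.symm (Iso.refl 0)
      (by simp) (by simp) (by simp)
  rw [charge_of_triangle Z hT, charge_of_isZero Z (isZero_zero C), add_zero]

/-- Rotating the contractible triangle gives $X\to0\to X[1]$. -/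
theorem charge_shift (Z : K₀ C →+ CLaurent) (X : C) : charge Z (X⟦(1 : ℤ)⟧) = -charge Z X := by
  have h := charge_obj₂ Z _ (rot_of_distTriang _ (contractible_distinguished X))
  have h0 : charge Z (0 : C) = charge Z X + charge Z (X⟦(1 : ℤ)⟧) := h
  rw [charge_of_isZero Z (isZero_zero C)] at h0
  exact eq_neg_of_add_eq_zero_right h0.symm

/-! ### Phases of objects of the heart -/

theorem isZero_heartCat_iff {t : TStructure C} (E : HeartCat t) : IsZero E ↔ IsZero E.obj := by
  rw [IsZero.iff_id_eq_zero, IsZero.iff_id_eq_zero]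
  constructor
  · intro h
    exact congrArg InducedCategory.Hom.hom h
  · intro h
    exact t.heart.ι.map_injective h

/-- Weak stability gives a polar form with radius only $\ge0$; a nonzero convergent series has no
zeros for large $v$, so the radius is positive. Choosing an angle for each $v$ produces a function
with which `phaseOf` must eventually agree. -/
theorem phase_spec {t : TStructure C} {a : ℝ → ℝ} {Z : K₀ C →+ CLaurent}
    (hZ : IsPolyStabilityFunction t a Z) {E : C} (hE : t.heart E) (h0 : ¬ IsZero E) :
    ∀ᶠ v in atTop, a v < phase a Z E v ∧ phase a Z E v ≤ a v + 1 ∧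
      ∃ r : ℝ, 0 < r ∧ evalAt (charge Z E).1 v = polar r (phase a Z E v) := by
  have h0' : ¬ IsZero (⟨E, hE⟩ : HeartCat t) := by rwa [isZero_heartCat_iff]
  have hne : charge Z E ≠ 0 := hZ.2 ⟨E, hE⟩ h0'
  have hne' : (charge Z E).1 ≠ 0 := fun h => hne (Subtype.ext h)
  have h1 : ∀ᶠ v in atTop, ∃ θ : ℝ, θ ∈ Set.Ioc (a v) (a v + 1) ∧ ∃ r : ℝ, 0 < r ∧
      evalAt (charge Z E).1 v = polar r θ := by
    filter_upwards [hZ.1.2 ⟨E, hE⟩ h0', IsConvergent.eventually_evalAt_ne_zero (charge Z E).2 hne']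
      with v hv hnz
    obtain ⟨r, θ, hr, hθ, he⟩ := hv
    refine ⟨θ, hθ, r, hr.lt_of_ne ?_, he⟩
    rintro rfl
    exact hnz (by rw [he]; simp)
  obtain ⟨φ, hφ⟩ := h1.choice
  have h2 : phase a Z E =ᶠ[atTop] φ :=
    phaseOf_eventuallyEq hne (hφ.mono fun v h => h.2) (hφ.mono fun v h => h.1.1)
      (hφ.mono fun v h => h.1.2)
  filter_upwards [hφ, h2] with v hv he
  rw [he]
  exact ⟨hv.1.1, hv.1.2, hv.2⟩

theorem phaseLE_iff {t : TStructure C} {a : ℝ → ℝ} {Z : K₀ C →+ CLaurent}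
    (hZ : IsPolyStabilityFunction t a Z) {E E' : C} (hE : t.heart E) (h0 : ¬ IsZero E)
    (hE' : t.heart E') (h0' : ¬ IsZero E') :
    PhaseLE (phase a Z E) (phase a Z E') ↔ NonnegCross (charge Z E) (charge Z E') := by
  refine eventually_congr ?_
  filter_upwards [phase_spec hZ hE h0, phase_spec hZ hE' h0'] with v h h'
  obtain ⟨h1, h2, r, hr, h3⟩ := h
  obtain ⟨h1', h2', r', hr', h3'⟩ := h'
  rw [h3, h3', cross_polar_nonneg_iff hr hr' (by linarith) (by linarith)]

theorem phaseLT_iff {t : TStructure C} {a : ℝ → ℝ} {Z : K₀ C →+ CLaurent}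
    (hZ : IsPolyStabilityFunction t a Z) {E E' : C} (hE : t.heart E) (h0 : ¬ IsZero E)
    (hE' : t.heart E') (h0' : ¬ IsZero E') :
    PhaseLT (phase a Z E) (phase a Z E') ↔ PosCross (charge Z E) (charge Z E') := by
  refine eventually_congr ?_
  filter_upwards [phase_spec hZ hE h0, phase_spec hZ hE' h0'] with v h h'
  obtain ⟨h1, h2, r, hr, h3⟩ := h
  obtain ⟨h1', h2', r', hr', h3'⟩ := h'
  rw [h3, h3', cross_polar_pos_iff hr hr' (by linarith) (by linarith)]

end Category


/-! ### The heart of a t-structure as an abelian category -/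

section Heart

open scoped ZeroObject

variable {C : Type*} [Category* C] [Preadditive C] [HasZeroObject C] [HasShift C ℤ]
  [∀ n : ℤ, (shiftFunctor C n).Additive] [Pretriangulated C] (t : TStructure C)

section Explicit

variable {t} {X : C}

theorem isLE_mono {p : ℤ} (h : t.IsLE X p) (q : ℤ) (hpq : p ≤ q := by lia) : t.IsLE X q :=
  t.isLE_of_le X p q

theorem isGE_mono {q : ℤ} (h : t.IsGE X q) (p : ℤ) (hpq : p ≤ q := by lia) : t.IsGE X p :=
  t.isGE_of_ge X p q

theorem isLE_shift_of {n : ℤ} (h : t.IsLE X n) (a n' : ℤ) (hn : a + n' = n := by lia) :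
    t.IsLE (X⟦a⟧) n' :=
  t.isLE_shift X n a n'

theorem isGE_shift_of {n : ℤ} (h : t.IsGE X n) (a n' : ℤ) (hn : a + n' = n := by lia) :
    t.IsGE (X⟦a⟧) n' :=
  t.isGE_shift X n a n'

end Explicit

section Triangle

variable {t} {X Y W : C} {f : X ⟶ Y} {g : Y ⟶ W} {h : W ⟶ X⟦(1 : ℤ)⟧}
  (hT : Triangle.mk f g h ∈ distTriang C)

include hT

theorem isLE_middle (n : ℤ) (h₁ : t.IsLE X n) (h₃ : t.IsLE W n) : t.IsLE Y n :=
  t.isLE₂ _ hT n h₁ h₃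

theorem isGE_middle (n : ℤ) (h₁ : t.IsGE X n) (h₃ : t.IsGE W n) : t.IsGE Y n :=
  t.isGE₂ _ hT n h₁ h₃

theorem isLE_cone (n : ℤ) (h₁ : t.IsLE X (n + 1)) (h₂ : t.IsLE Y n) : t.IsLE W n :=
  t.isLE₂ _ (rot_of_distTriang _ hT) n h₂ (isLE_shift_of h₁ 1 n)

theorem isGE_cone (n : ℤ) (h₁ : t.IsGE X (n + 1)) (h₂ : t.IsGE Y n) : t.IsGE W n :=
  t.isGE₂ _ (rot_of_distTriang _ hT) n h₂ (isGE_shift_of h₁ 1 n)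

theorem isGE_fibre (n : ℤ) (h₂ : t.IsGE Y n) (h₃ : t.IsGE W (n - 1)) : t.IsGE X n :=
  t.isGE₂ _ (inv_rot_of_distTriang _ hT) n (isGE_shift_of h₃ (-1) n) h₂

theorem heart_middle (h₁ : t.heart X) (h₃ : t.heart W) : t.heart Y := by
  rw [t.mem_heart_iff] at *
  exact ⟨isLE_middle hT 0 h₁.1 h₃.1, isGE_middle hT 0 h₁.2 h₃.2⟩

end Triangle

theorem heart_of_isZero {X : C} (hX : IsZero X) : t.heart X :=
  (t.mem_heart_iff X).2 ⟨t.isLE_of_isZero hX 0, t.isGE_of_isZero hX 0⟩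

instance : t.heart.ContainsZero :=
  ⟨0, isZero_zero C, heart_of_isZero t (isZero_zero C)⟩

instance : t.heart.IsClosedUnderBinaryProducts where
  limitsOfShape_le := by
    rintro X ⟨p⟩
    have h := heart_middle (binaryProductTriangle_distinguished _ _)
      (p.prop_diag_obj (.mk .left)) (p.prop_diag_obj (.mk .right))
    refine t.heart.prop_of_iso ?_ h
    exact IsLimit.conePointUniqueUpToIso (prodIsProd _ _)
      ((IsLimit.postcomposeHomEquiv (diagramIsoPair p.diag) _).2 p.isLimit)

instance : t.heart.IsClosedUnderFiniteProducts := .mk'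

variable {t} in
-- Vanishing of negative extensions: one of the two conditions under which a full subcategory of a
-- triangulated category is abelian. The other is `admissibleMorphism_heart`.
theorem heart_hom_shift_eq_zero ⦃X Y : HeartCat t⦄ ⦃n : ℤ⦄
    (f : t.heart.ι.obj X ⟶ (t.heart.ι.obj Y)⟦n⟧) (hn : n < 0) : f = 0 := by
  have h1 := ((t.mem_heart_iff _).1 X.property).1
  have h2 := ((t.mem_heart_iff _).1 Y.property).2
  exact t.zero_of_isLE_of_isGE f 0 (-n) (by lia) h1 (isGE_shift_of h2 n (-n))

theorem exists_triangle_heart {X : C} (h1 : t.IsLE X 0) (h2 : t.IsGE X (-1)) :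
    ∃ (K Q : HeartCat t) (f : K.obj⟦(1 : ℤ)⟧ ⟶ X) (g : X ⟶ Q.obj)
      (h : Q.obj ⟶ (K.obj⟦(1 : ℤ)⟧)⟦(1 : ℤ)⟧), Triangle.mk f g h ∈ distTriang C := by
  obtain ⟨A, B, hA, hB, f, g, h, hT⟩ := t.exists_triangle X (-1) 0 (by lia)
  have hA : t.IsLE A (-1) := ⟨hA⟩
  have hB : t.IsGE B 0 := ⟨hB⟩
  have hA' : t.IsGE A (-1) :=
    isGE_fibre hT (-1) h2 (isGE_mono hB (-1 - 1))
  have hB' : t.IsLE B 0 := isLE_cone hT 0 (isLE_mono hA (0 + 1)) h1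
  let e : (A⟦(-1 : ℤ)⟧)⟦(1 : ℤ)⟧ ≅ A := (shiftEquiv C (1 : ℤ)).counitIso.app A
  refine ⟨⟨A⟦(-1 : ℤ)⟧, ?_⟩, ⟨B, ?_⟩, e.hom ≫ f, g, h ≫ e.inv⟦(1 : ℤ)⟧', ?_⟩
  · exact (t.mem_heart_iff _).2 ⟨isLE_shift_of hA (-1) 0, isGE_shift_of hA' (-1) 0⟩
  · exact (t.mem_heart_iff _).2 ⟨hB', hB⟩
  · exact distTriang_of_iso hT e (Iso.refl X) (Iso.refl B) (by simp) (by simp)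
      (by simp [← Functor.map_comp])

/-- The cone of a morphism of the heart has amplitude $[-1,0]$. Its truncation triangle $K[1]\to
X_3\to Q$ supplies the kernel $K$ and the cokernel $Q$. -/
theorem admissibleMorphism_heart :
    AbelianSubcategory.admissibleMorphism (t.heart.ι) = ⊤ := by
  ext X₁ X₂ f₁
  simp only [MorphismProperty.top_apply, iff_true]
  intro X₃ f₂ f₃ hT
  have h1 := (t.mem_heart_iff _).1 X₁.property
  have h2 := (t.mem_heart_iff _).1 X₂.property
  exact exists_triangle_heart t (isLE_cone hT 0 (isLE_mono h1.1 (0 + 1)) h2.1)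
    (isGE_cone hT (-1) h1.2 (isGE_mono h2.2 (-1)))

variable [IsTriangulated C]

noncomputable instance heartAbelian : Abelian (HeartCat t) :=
  AbelianSubcategory.abelian t.heart.ι heart_hom_shift_eq_zero (admissibleMorphism_heart t)

variable {t}

/-- A distinguished triangle with vertices in the heart is a short exact sequence. -/
theorem shortExact_of_triangle {X Y W : HeartCat t} (f : X ⟶ Y) (g : Y ⟶ W)
    (h : W.obj ⟶ X.obj⟦(1 : ℤ)⟧)
    (hT : Triangle.mk (t.heart.ι.map f) (t.heart.ι.map g) h ∈ distTriang C) :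
    ∃ w : f ≫ g = 0, (ShortComplex.mk f g w).ShortExact := by
  have h1 := AbelianSubcategory.isLimitKernelForkOfDistTriang heart_hom_shift_eq_zero f g h hT
  have h2 :=
    AbelianSubcategory.isColimitCokernelCoforkOfDistTriang heart_hom_shift_eq_zero f g h hT
  refine ⟨t.heart.ι.map_injective ?_, ?_⟩
  · have := comp_distTriang_mor_zero₁₂ _ hT
    rw [Functor.map_comp, Functor.map_zero]
    exact this
  · refine ShortComplex.ShortExact.mk' (ShortComplex.exact_of_f_is_kernel _ h1) ?_ ?_
    · exact mono_of_isLimit_fork h1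
    · exact epi_of_isColimit_cofork h2

/-- A short exact sequence in the heart extends to a distinguished triangle. -/
theorem exists_triangle_of_shortExact {S : ShortComplex (HeartCat t)} (hS : S.ShortExact) :
    ∃ h : S.X₃.obj ⟶ S.X₁.obj⟦(1 : ℤ)⟧,
      Triangle.mk (t.heart.ι.map S.f) (t.heart.ι.map S.g) h ∈ distTriang C := by
  have := hS.epi_g
  obtain ⟨K, i, δ, hT⟩ := AbelianSubcategory.exists_distinguished_triangle_of_epi
    heart_hom_shift_eq_zero (admissibleMorphism_heart t) S.g
  obtain ⟨w, hw⟩ := shortExact_of_triangle i S.g δ hT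
  let e : S.X₁ ≅ K := IsLimit.conePointUniqueUpToIso hS.fIsKernel hw.fIsKernel
  have he : e.hom ≫ i = S.f :=
    IsLimit.conePointUniqueUpToIso_hom_comp hS.fIsKernel hw.fIsKernel WalkingParallelPair.zero
  refine ⟨δ ≫ (t.heart.ι.map e.inv)⟦(1 : ℤ)⟧', ?_⟩
  refine distTriang_of_iso hT (t.heart.ι.mapIso e) (Iso.refl _) (Iso.refl _) ?_ ?_ ?_
  · simp [← he]
  · simp
  · rw [Category.assoc, ← Functor.map_comp, Functor.mapIso_hom, ← Functor.map_comp, e.inv_hom_id]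
    simp

/-- Semistability tested on distinguished triangles with vertices in the heart. -/
theorem isSemistable_iff {a : ℝ → ℝ} {Z : K₀ C →+ CLaurent}
    (hZ : IsPolyStabilityFunction t a Z) (E : HeartCat t) :
    IsSemistable t a Z E ↔ ¬ IsZero E ∧ ∀ ⦃M N : C⦄ (f : M ⟶ E.obj) (g : E.obj ⟶ N)
      (h : N ⟶ M⟦(1 : ℤ)⟧), Triangle.mk f g h ∈ distTriang C → t.heart M → t.heart N →
        NonnegCross (charge Z M) (charge Z E.obj) := by
  refine and_congr_right fun hE0 => ⟨fun H M N f g h hT hM hN => ?_, fun H M N i p w hS hM hN => ?_⟩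
  · rw [charge_of_triangle Z hT]
    by_cases hM0 : IsZero M
    · rw [charge_of_isZero Z hM0]
      exact nonnegCross_zero_left _
    by_cases hN0 : IsZero N
    · rw [charge_of_isZero Z hN0, add_zero]
      exact nonnegCross_self _
    obtain ⟨w, hS⟩ := shortExact_of_triangle (X := ⟨M, hM⟩) (Y := E) (W := ⟨N, hN⟩)
      (ObjectProperty.homMk f) (ObjectProperty.homMk g) h hT
    have h1 := H ⟨M, hM⟩ ⟨N, hN⟩ _ _ w hS (by rwa [isZero_heartCat_iff])
      (by rwa [isZero_heartCat_iff])
    rw [nonnegCross_add_right_self]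
    exact (phaseLE_iff hZ hM hM0 hN hN0).1 h1
  · obtain ⟨h, hT⟩ := exists_triangle_of_shortExact hS
    have h1 := H _ _ _ hT M.property N.property
    rw [isZero_heartCat_iff] at hM hN
    rw [phaseLE_iff hZ M.property hM N.property hN, ← nonnegCross_add_right_self]
    exact charge_of_triangle Z hT ▸ h1

end Heart


/-! ### Cohomological amplitude -/

theorem isZero_of_isZero_map {C C' : Type*} [Category* C] [Category* C'] [HasZeroMorphisms C]
    [HasZeroMorphisms C'] (F : C ⥤ C') [F.Faithful] [F.PreservesZeroMorphisms] {X : C}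
    (h : IsZero (F.obj X)) : IsZero X := by
  rw [IsZero.iff_id_eq_zero] at h ⊢
  exact F.map_injective (by rw [F.map_id, F.map_zero, h])

section Shift

variable {C : Type*} [Category* C] [Preadditive C] [HasShift C ℤ]
  [∀ n : ℤ, (shiftFunctor C n).Additive]

theorem isZero_of_isZero_shift {X : C} (n : ℤ) (h : IsZero (X⟦n⟧)) : IsZero X :=
  isZero_of_isZero_map (shiftFunctor C n) h

end Shift

section Amplitude

variable {C : Type*} [Category* C] [Preadditive C] [HasZeroObject C] [HasShift C ℤ]
  [∀ n : ℤ, (shiftFunctor C n).Additive] [Pretriangulated C]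

theorem triangle_shift_distinguished {X Y W : C} {f : X ⟶ Y} {g : Y ⟶ W} {h : W ⟶ X⟦(1 : ℤ)⟧}
    (hT : Triangle.mk f g h ∈ distTriang C) :
    Triangle.mk (f⟦(1 : ℤ)⟧') (g⟦(1 : ℤ)⟧') (-h⟦(1 : ℤ)⟧') ∈ distTriang C := by
  have h3 := rot_of_distTriang _ (rot_of_distTriang _ (rot_of_distTriang _ hT))
  have h3' : Triangle.mk (-f⟦(1 : ℤ)⟧') (-g⟦(1 : ℤ)⟧') (-h⟦(1 : ℤ)⟧') ∈ distTriang C := h3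
  -- Three rotations negate all three maps; the automorphism $-1$ of the middle vertex absorbs two
  -- of the signs.
  exact distTriang_of_iso h3' (Iso.refl _) (-Iso.refl _) (Iso.refl _) (by simp) (by simp)
    (by simp)

variable {t : TStructure C}

/-- If $X$ is in degrees $\ge n$, then $X\cong\tau_{\ge n}X$ and $H^n(X)$ is $\tau_{\le n}X$ up to a
shift. Its vanishing raises the lower bound by one. Boundedness gives a bound to start from, and
iterating turns vanishing cohomology into an amplitude statement. -/
theorem isGE_succ_of_cohomology {X : C} {n : ℤ} (hX : t.IsGE X n)
    (h : IsZero (cohomology t n X)) : t.IsGE X (n + 1) := by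
  rw [t.isGE_iff_isZero_truncLE_obj n (n + 1) rfl]
  exact (isZero_of_isZero_shift n h).of_iso
    ((t.truncLE n).mapIso (asIso ((t.truncGEπ n).app X)))

theorem isLE_pred_of_cohomology [IsTriangulated C] {X : C} {n : ℤ} (hX : t.IsLE X n)
    (h : IsZero (cohomology t n X)) : t.IsLE X (n - 1) := by
  rw [t.isLE_iff_isZero_truncGE_obj (n - 1) n (by lia)]
  exact (isZero_of_isZero_shift n h).of_iso
    (asIso ((t.truncLEι n).app ((t.truncGE n).obj X))).symm

theorem isGE_of_isInRange (ht : IsBounded t) {X : C} {p q : ℤ} (h : IsInRange t p q X) :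
    t.IsGE X p := by
  obtain ⟨m, hm⟩ := (ht X).1
  rcases le_total p m with hpm | hpm
  · exact isGE_mono hm p
  · suffices ∀ k : ℕ, m + k ≤ p → t.IsGE X (m + k) by
      have := this (p - m).toNat (by lia)
      rwa [show m + ((p - m).toNat : ℤ) = p by lia] at this
    intro k
    induction k with
    | zero => intro _; simpa using hm
    | succ k ih =>
      intro hk
      push_cast at hk ⊢
      rw [← add_assoc]
      exact isGE_succ_of_cohomology (ih (by lia)) (h _ (by simp only [Set.mem_Icc]; lia))

theorem isLE_of_isInRange [IsTriangulated C] (ht : IsBounded t) {X : C} {p q : ℤ} (h : IsInRange t p q X) :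
    t.IsLE X q := by
  obtain ⟨m, hm⟩ := (ht X).2
  rcases le_total m q with hpm | hpm
  · exact isLE_mono hm q
  · suffices ∀ k : ℕ, q ≤ m - k → t.IsLE X (m - k) by
      have := this (m - q).toNat (by lia)
      rwa [show m - ((m - q).toNat : ℤ) = q by lia] at this
    intro k
    induction k with
    | zero => intro _; simpa using hm
    | succ k ih =>
      intro hk
      push_cast at hk ⊢
      rw [← sub_sub]
      exact isLE_pred_of_cohomology (ih (by lia)) (h _ (by simp only [Set.mem_Icc]; lia))

end Amplitude

/-! ### Pairs of t-structures that are related by tilting -/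

section Tilting

variable {C : Type*} [Category* C] [Preadditive C] [HasZeroObject C] [HasShift C ℤ]
  [∀ n : ℤ, (shiftFunctor C n).Additive] [Pretriangulated C]

/-- The heart of `t` is contained in `D^{[0,1]}` for `t'`. -/
structure IsTilt (t t' : TStructure C) : Prop where
  bounded : IsBounded t
  isLE_one : ∀ ⦃X : C⦄, t.heart X → t'.IsLE X 1
  isGE_zero : ∀ ⦃X : C⦄, t.heart X → t'.IsGE X 0

/-- The torsion class: the intersection of the two hearts. -/
def IsTorsion (t t' : TStructure C) (X : C) : Prop := t.heart X ∧ t'.heart X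

/-- The torsion-free class: objects of the heart of `t` whose shift is in the heart of `t'`. -/
def IsTorsionFree (t t' : TStructure C) (X : C) : Prop := t.heart X ∧ t'.heart (X⟦(1 : ℤ)⟧)

variable {t t' : TStructure C}

theorem IsTorsion.of_iso {X Y : C} (e : X ≅ Y) (hX : IsTorsion t t' X) : IsTorsion t t' Y :=
  ⟨t.heart.prop_of_iso e hX.1, t'.heart.prop_of_iso e hX.2⟩

theorem IsTorsionFree.of_iso {X Y : C} (e : X ≅ Y) (hX : IsTorsionFree t t' X) :
    IsTorsionFree t t' Y :=
  ⟨t.heart.prop_of_iso e hX.1, t'.heart.prop_of_iso ((shiftFunctor C (1 : ℤ)).mapIso e) hX.2⟩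

theorem IsTorsion.hom_eq_zero {X Y : C} (hX : IsTorsion t t' X) (hY : IsTorsionFree t t' Y)
    (f : X ⟶ Y) : f = 0 := by
  have h1 := ((t'.mem_heart_iff _).1 hX.2).1
  have h2 := ((t'.mem_heart_iff _).1 hY.2).2
  exact t'.zero_of_isLE_of_isGE f 0 1 (by lia) h1 (t'.isGE_of_shift Y 1 1 0)

variable (h : IsTilt t t')

include h

/-- Dévissage: by boundedness the object has finite amplitude for `t`, and the piece in lowest
degree is split off by induction on the width. -/
theorem IsTilt.isLE_one_of_isLE_zero {X : C} (hX : t.IsLE X 0) : t'.IsLE X 1 := by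
  obtain ⟨m, hm⟩ := (h.bounded X).1
  suffices ∀ (k : ℕ) (X : C), t.IsLE X 0 → t.IsGE X (-k) → t'.IsLE X 1 from
    this m.natAbs X hX (isGE_mono hm _)
  intro k
  induction k with
  | zero => exact fun X h0 h1 => h.isLE_one ((t.mem_heart_iff _).2 ⟨h0, by simpa using h1⟩)
  | succ k ih =>
    intro X h0 h1
    obtain ⟨A, B, hA, hB, f, g, δ, hT⟩ := t.exists_triangle X (-(k + 1)) (-k) (by lia)
    have hA : t.IsLE A (-(k + 1)) := ⟨hA⟩
    have hB : t.IsGE B (-k) := ⟨hB⟩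
    push_cast at h1
    have hA' : t.IsGE A (-(k + 1)) := isGE_fibre hT _ h1 (isGE_mono hB _)
    have hB' : t.IsLE B 0 := isLE_cone hT 0 (isLE_mono hA _) h0
    -- `A` is concentrated in `t`-degree $-(k+1)$. Its shift is an object of the heart, hence in
    -- `t'`-degrees $\le1$, and so `A` is in `t'`-degrees $\le-k\le1$.
    have hA'' := h.isLE_one ((t.mem_heart_iff (A⟦(-(k + 1) : ℤ)⟧)).2
      ⟨isLE_shift_of hA _ _, isGE_shift_of hA' _ _⟩)
    exact isLE_middle hT 1 (isLE_mono (t'.isLE_of_shift A (1 - (k + 1)) (-(k + 1)) 1) 1)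
      (ih B hB' hB)

theorem IsTilt.isGE_zero_of_isGE_zero {X : C} (hX : t.IsGE X 0) : t'.IsGE X 0 := by
  obtain ⟨m, hm⟩ := (h.bounded X).2
  suffices ∀ (k : ℕ) (X : C), t.IsGE X 0 → t.IsLE X k → t'.IsGE X 0 from
    this m.natAbs X hX (isLE_mono hm _)
  intro k
  induction k with
  | zero => exact fun X h0 h1 => h.isGE_zero ((t.mem_heart_iff _).2 ⟨by simpa using h1, h0⟩)
  | succ k ih =>
    intro X h0 h1
    obtain ⟨A, B, hA, hB, f, g, δ, hT⟩ := t.exists_triangle X k (k + 1) (by lia)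
    have hA : t.IsLE A k := ⟨hA⟩
    have hB : t.IsGE B (k + 1) := ⟨hB⟩
    push_cast at h1
    have hB' : t.IsLE B (k + 1) := isLE_cone hT _ (isLE_mono hA _) h1
    have hA' : t.IsGE A 0 := isGE_fibre hT 0 h0 (isGE_mono hB _)
    have hB'' := h.isGE_zero ((t.mem_heart_iff (B⟦(k + 1 : ℤ)⟧)).2
      ⟨isLE_shift_of hB' _ _, isGE_shift_of hB _ _⟩)
    exact isGE_middle hT 0 (ih A hA' hA)
      (isGE_mono (t'.isGE_of_shift B (k + 1) (k + 1) 0) 0)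

/-- Passage to orthogonals: an object in `t`-degrees $\ge1$ is in `t'`-degrees $\ge1$, so nothing in
`t'`-degrees $\le0$ maps to it. -/
theorem IsTilt.isLE_zero {X : C} (hX : t'.IsLE X 0) : t.IsLE X 0 := by
  rw [t.isLE_iff_orthogonal 0 1 (by lia)]
  intro Y f hY
  have h1 := h.isGE_zero_of_isGE_zero (isGE_shift_of hY 1 0)
  exact t'.zero_of_isLE_of_isGE f 0 1 (by lia) hX (t'.isGE_of_shift Y 1 1 0)

theorem IsTilt.isGE_neg_one {X : C} (hX : t'.IsGE X 0) : t.IsGE X (-1) := by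
  rw [t.isGE_iff_orthogonal (-2) (-1) (by lia)]
  intro Y f hY
  have h1 := h.isLE_one_of_isLE_zero (isLE_shift_of hY (-2) 0)
  exact t'.zero_of_isLE_of_isGE f (-1) 0 (by lia) (t'.isLE_of_shift Y (-1) (-2) 1) hX

/-- The torsion sequence is the truncation triangle of $E$ for `t'`. Comparing the two t-structures
in the reverse direction shows that its vertices lie in the heart of `t`. -/
theorem IsTilt.exists_torsion_triangle {E : C} (hE : t.heart E) :
    ∃ (P Q : C) (f : P ⟶ E) (g : E ⟶ Q) (δ : Q ⟶ P⟦(1 : ℤ)⟧),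
      Triangle.mk f g δ ∈ distTriang C ∧ IsTorsion t t' P ∧ IsTorsionFree t t' Q := by
  obtain ⟨P, Q, hP, hQ, f, g, δ, hT⟩ := t'.exists_triangle E 0 1 (by lia)
  have hP : t'.IsLE P 0 := ⟨hP⟩
  have hQ : t'.IsGE Q 1 := ⟨hQ⟩
  have hP' : t'.IsGE P 0 := isGE_fibre hT 0 (h.isGE_zero hE) (isGE_mono hQ _)
  have hQ' : t'.IsLE Q 1 := isLE_cone hT 1 (isLE_mono hP _) (h.isLE_one hE)
  have hE := (t.mem_heart_iff _).1 hE
  have hP1 := h.isLE_zero hP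
  have hQ1' := h.isGE_neg_one (isGE_shift_of hQ 1 0)
  have hQ1 : t.IsGE Q 0 := t.isGE_of_shift Q 0 1 (-1)
  refine ⟨P, Q, f, g, δ, hT, ⟨(t.mem_heart_iff _).2 ⟨hP1, ?_⟩, (t'.mem_heart_iff _).2 ⟨hP, hP'⟩⟩,
    (t.mem_heart_iff _).2 ⟨?_, hQ1⟩,
    (t'.mem_heart_iff _).2 ⟨isLE_shift_of hQ' 1 0, isGE_shift_of hQ 1 0⟩⟩
  · exact isGE_fibre hT 0 hE.2 (isGE_mono hQ1 _)
  · exact isLE_cone hT 0 (isLE_mono hP1 _) hE.1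

/-- $K[1]$ is in `t'`-degrees $\le0$ and $R$ in `t'`-degrees $\ge0$; the triangle and $X$ in the
heart of `t'` give the two opposite bounds. Thus membership in the two classes is automatic for any
such triangle. -/
theorem IsTilt.isTorsionFree_and_isTorsion {X K R : C} {f : K⟦(1 : ℤ)⟧ ⟶ X} {g : X ⟶ R}
    {δ : R ⟶ (K⟦(1 : ℤ)⟧)⟦(1 : ℤ)⟧} (hT : Triangle.mk f g δ ∈ distTriang C) (hX : t'.heart X)
    (hK : t.heart K) (hR : t.heart R) : IsTorsionFree t t' K ∧ IsTorsion t t' R := by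
  have hX := (t'.mem_heart_iff _).1 hX
  have hK1 : t'.IsLE (K⟦(1 : ℤ)⟧) 0 := isLE_shift_of (h.isLE_one hK) 1 0
  have hR0 := h.isGE_zero hR
  refine ⟨⟨hK, (t'.mem_heart_iff _).2 ⟨hK1, ?_⟩⟩, hR, (t'.mem_heart_iff _).2 ⟨?_, hR0⟩⟩
  · exact isGE_fibre hT 0 hX.2 (isGE_mono hR0 _)
  · exact isLE_cone hT 0 (isLE_mono hK1 _) hX.1

/-- The decomposition of an object of the heart of `t'` for the tilted torsion pair. -/
theorem IsTilt.exists_torsion_triangle' {X : C} (hX : t'.heart X) :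
    ∃ (K R : C) (f : K⟦(1 : ℤ)⟧ ⟶ X) (g : X ⟶ R) (δ : R ⟶ (K⟦(1 : ℤ)⟧)⟦(1 : ℤ)⟧),
      Triangle.mk f g δ ∈ distTriang C ∧ IsTorsionFree t t' K ∧ IsTorsion t t' R := by
  have hX' := (t'.mem_heart_iff _).1 hX
  obtain ⟨K, R, f, g, δ, hT⟩ :=
    exists_triangle_heart t (h.isLE_zero hX'.1) (h.isGE_neg_one hX'.2)
  exact ⟨K.obj, R.obj, f, g, δ, hT,
    h.isTorsionFree_and_isTorsion hT hX K.property R.property⟩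

end Tilting

/-! ### Transport of a t-structure along an exact equivalence -/

section Transport

variable {D : Type*} [Category* D] [Preadditive D] [HasZeroObject D] [HasShift D ℤ]
  [∀ n : ℤ, (shiftFunctor D n).Additive] [Pretriangulated D]
  {U : Type*} [Category* U] [Preadditive U] [HasZeroObject U] [HasShift U ℤ]
  [∀ n : ℤ, (shiftFunctor U n).Additive] [Pretriangulated U]
  (Φ : D ⥤ U) [Φ.CommShift ℤ] [Φ.IsTriangulated]

theorem map_triangle_distinguished {X Y W : D} {f : X ⟶ Y} {g : Y ⟶ W} {h : W ⟶ X⟦(1 : ℤ)⟧}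
    (hT : Triangle.mk f g h ∈ distTriang D) :
    Triangle.mk (Φ.map f) (Φ.map g) (Φ.map h ≫ (Φ.commShiftIso (1 : ℤ)).hom.app X) ∈
      distTriang U :=
  Φ.map_distinguished _ hT

variable [Φ.IsEquivalence]

/-- Essential surjectivity and fullness lift the first morphism, and the cone of the lift maps to
the cone of the original. Short exact sequences in $\mathcal B$ can thereby be tested in $\mathcal
D$. -/
theorem exists_triangle_preimage {P Q : U} {E : D} {f : P ⟶ Φ.obj E} {g : Φ.obj E ⟶ Q}
    {h : Q ⟶ P⟦(1 : ℤ)⟧} (hT : Triangle.mk f g h ∈ distTriang U) :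
    ∃ (P' Q' : D) (f' : P' ⟶ E) (g' : E ⟶ Q') (h' : Q' ⟶ P'⟦(1 : ℤ)⟧),
      Triangle.mk f' g' h' ∈ distTriang D ∧ Nonempty (Φ.obj P' ≅ P) ∧ Nonempty (Φ.obj Q' ≅ Q) := by
  let e := Φ.objObjPreimageIso P
  obtain ⟨Q', g', h', hT'⟩ := distinguished_cocone_triangle (Φ.preimage (e.hom ≫ f))
  have hm := map_triangle_distinguished Φ hT'
  rw [Φ.map_preimage] at hm
  let i := isoTriangleOfIso₁₂ _ _ hm hT e (Iso.refl _) (Category.comp_id _)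
  exact ⟨_, Q', _, g', h', hT', ⟨e⟩, ⟨Triangle.π₃.mapIso i⟩⟩

/-- The t-structure on `D` obtained from one on `U` along an exact equivalence `D ⥤ U`. -/
def transport (t : TStructure U) : TStructure D where
  le n := (t.le n).inverseImage Φ
  ge n := (t.ge n).inverseImage Φ
  le_shift n a n' h X hX :=
    (t.le n').prop_of_iso ((Φ.commShiftIso a).app X).symm (t.le_shift n a n' h _ hX)
  ge_shift n a n' h X hX :=
    (t.ge n').prop_of_iso ((Φ.commShiftIso a).app X).symm (t.ge_shift n a n' h _ hX)
  zero' X Y f hX hY := Φ.map_injective (by rw [Φ.map_zero]; exact t.zero' _ hX hY)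
  le_zero_le X hX := t.le_zero_le _ hX
  ge_one_le X hX := t.ge_one_le _ hX
  exists_triangle_zero_one A := by
    obtain ⟨X, Y, hX, hY, f, g, h, hT⟩ := t.exists_triangle_zero_one (Φ.obj A)
    obtain ⟨X', Y', f', g', h', hT', ⟨e⟩, ⟨e'⟩⟩ := exists_triangle_preimage Φ hT
    exact ⟨X', Y', (t.le 0).prop_of_iso e.symm hX, (t.ge 1).prop_of_iso e'.symm hY, f', g', h', hT'⟩

theorem transport_heart_iff (t : TStructure U) (X : D) :
    (transport Φ t).heart X ↔ t.heart (Φ.obj X) :=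
  Iff.rfl

theorem isTilt_transport [IsTriangulated U] {tA : TStructure D} {tB : TStructure U}
    (hA : IsBounded tA) (hB : IsBounded tB)
    (hΦ : ∀ E : HeartCat tA, IsInRange tB 0 1 (Φ.obj E.obj)) : IsTilt tA (transport Φ tB) where
  bounded := hA
  isLE_one X hX := ⟨(isLE_of_isInRange hB (hΦ ⟨X, hX⟩)).le⟩
  isGE_zero X hX := ⟨(isGE_of_isInRange hB (hΦ ⟨X, hX⟩)).ge⟩

end Transport


/-! ### Semistability in the two hearts -/

theorem polar_add_one (r θ : ℝ) : polar r (θ + 1) = -polar r θ := by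
  apply Complex.ext
  · rw [Complex.neg_re, polar_re, polar_re, mul_add, mul_one, Real.cos_add_pi]; ring
  · rw [Complex.neg_im, polar_im, polar_im, mul_add, mul_one, Real.sin_add_pi]; ring

theorem LiftedPath.evalAt_act_of_polar {T : GL (Fin 2) RLaurent} (Γ : LiftedPath T)
    (f : CLaurent) : ∀ᶠ v in atTop, ∀ r θ : ℝ, 0 < r → evalAt f.1 v = polar r θ →
      ∃ s : ℝ, 0 < s ∧ evalAt (act T f).1 v = polar s (Γ.g v θ) := by
  filter_upwards [evalAt_act T f, eventually_ge_atTop Γ.v₁] with v h hv r θ hr hf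
  obtain ⟨ρ, hρ, hc⟩ := Γ.compat v hv θ
  have h0 := congrFun hc 0
  have h1 := congrFun hc 1
  simp only [Matrix.mulVec, dotProduct, Fin.sum_univ_two, Matrix.cons_val_zero,
    Matrix.cons_val_one, Pi.smul_apply, smul_eq_mul] at h0 h1
  refine ⟨r * ρ, mul_pos hr hρ, ?_⟩
  rw [h, hf, polar_re, polar_im]
  apply Complex.ext
  · rw [polar_re, mul_assoc, ← h0]
    ring
  · rw [polar_im, mul_assoc, ← h1]
    ring

section Configuration

variable {D : Type*} [Category* D] [Preadditive D] [HasZeroObject D] [HasShift D ℤ]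
  [∀ n : ℤ, (shiftFunctor D n).Additive] [Pretriangulated D]
  {U : Type*} [Category* U] [Preadditive U] [HasZeroObject U] [HasShift U ℤ]
  [∀ n : ℤ, (shiftFunctor U n).Additive] [Pretriangulated U]
  (Φ : D ⥤ U) [Φ.CommShift ℤ] [Φ.IsTriangulated] [Φ.IsEquivalence]

/-- Stability functions on the hearts of two t-structures that are related by an exact equivalence
and an orientation preserving matrix. -/
structure StabilityTilt (tA : TStructure D) (tB : TStructure U) (a b : ℝ → ℝ)
    (ZA : K₀ D →+ CLaurent) (ZB : K₀ U →+ CLaurent) {T : GL (Fin 2) RLaurent}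
    (Γ : LiftedPath T) : Prop where
  tilt : IsTilt tA (transport Φ tB)
  left : IsPolyStabilityFunction tA a ZA
  right : IsPolyStabilityFunction tB b ZB
  orientation : IsOrientationPreserving T
  charge_eq : ∀ E : D, charge ZB (Φ.obj E) = act T (charge ZA E)
  lt_left : PhaseLT a (Γ.GammaInv b)
  lt_right : PhaseLT (Γ.GammaInv b) (fun v => a v + 1)

variable {Φ} {tA : TStructure D} {tB : TStructure U} {a b : ℝ → ℝ}
  {ZA : K₀ D →+ CLaurent} {ZB : K₀ U →+ CLaurent} {T : GL (Fin 2) RLaurent} {Γ : LiftedPath T}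
  (c : StabilityTilt Φ tA tB a b ZA ZB Γ)

theorem isZero_map_iff {X : D} : IsZero (Φ.obj X) ↔ IsZero X :=
  ⟨isZero_of_isZero_map Φ, Φ.map_isZero⟩

include c

theorem StabilityTilt.eventually_bounds : ∀ᶠ v in atTop, Γ.v₁ ≤ v ∧ Γ.g v (a v) < b v ∧
    b v < Γ.g v (a v) + 1 := by
  filter_upwards [c.lt_left, c.lt_right, eventually_ge_atTop Γ.v₁] with v h1 h2 hv
  refine ⟨hv, (Γ.g v).lt_symm_apply.1 h1, ?_⟩
  rw [← Γ.g_add_one v hv]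
  exact (Γ.g v).symm_apply_lt.1 h2

/-- Both $g_v(\phi_{\mathcal A}(E))$ and $\phi_{\mathcal B}(\Phi E)$ are phases of the same number,
so they differ by an even integer. The windows $(g_v(a),g_v(a)+1]$ and $(b,b+1]$ are offset by less
than $1$, which forces equality. -/
theorem StabilityTilt.phase_torsion {E : D} (hE : IsTorsion tA (transport Φ tB) E)
    (h0 : ¬ IsZero E) : PhaseLT (Γ.GammaInv b) (phase a ZA E) := by
  filter_upwards [c.eventually_bounds, phase_spec c.left hE.1 h0,
    phase_spec c.right (E := Φ.obj E) hE.2 (by rwa [isZero_map_iff]),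
    Γ.evalAt_act_of_polar (charge ZA E)] with v hv hA hB hact
  obtain ⟨hv, hab, hba⟩ := hv
  obtain ⟨h1, h2, r, hr, h3⟩ := hA
  obtain ⟨h1', h2', s, hs, h3'⟩ := hB
  obtain ⟨s', hs', h4⟩ := hact r _ hr h3
  rw [c.charge_eq, h4] at h3'
  obtain ⟨n, hn⟩ := eq_add_two_mul_of_polar_eq hs' hs h3'
  have h5 := (Γ.g v).lt_iff_lt.2 h1
  have h6 := (Γ.g v).le_iff_le.2 h2
  rw [Γ.g_add_one v hv] at h6
  -- The difference `2 * n` lies above `g a - b - 1 > -2` and below `g a + 1 - b < 1`.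
  have hn1 : (-1 : ℝ) < n := by linarith
  have hn2 : (n : ℝ) < 1 := by linarith
  have hn0 : n = 0 := by
    have : (-1 : ℤ) < n := by exact_mod_cast hn1
    have : n < (1 : ℤ) := by exact_mod_cast hn2
    lia
  rw [hn0, Int.cast_zero, mul_zero, add_zero] at hn
  refine (Γ.g v).symm_apply_lt.2 ?_
  rw [hn]
  exact h1'

theorem StabilityTilt.phase_torsionFree {E : D} (hE : IsTorsionFree tA (transport Φ tB) E)
    (h0 : ¬ IsZero E) : PhaseLE (phase a ZA E) (Γ.GammaInv b) := by
  filter_upwards [c.eventually_bounds, phase_spec c.left hE.1 h0,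
    phase_spec c.right (E := Φ.obj (E⟦(1 : ℤ)⟧)) hE.2
      (by rw [isZero_map_iff]; exact fun h => h0 (isZero_of_isZero_shift 1 h)),
    Γ.evalAt_act_of_polar (charge ZA (E⟦(1 : ℤ)⟧))] with v hv hA hB hact
  obtain ⟨hv, hab, hba⟩ := hv
  obtain ⟨h1, h2, r, hr, h3⟩ := hA
  obtain ⟨h1', h2', s, hs, h3'⟩ := hB
  obtain ⟨s', hs', h4⟩ := hact r (phase a ZA E v + 1) hr
    (by rw [charge_shift, evalAt_neg_charge, h3, polar_add_one])
  rw [c.charge_eq, h4] at h3'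
  obtain ⟨n, hn⟩ := eq_add_two_mul_of_polar_eq hs' hs h3'
  have h5 := (Γ.g v).lt_iff_lt.2 h1
  have h6 := (Γ.g v).le_iff_le.2 h2
  rw [Γ.g_add_one v hv] at h6 hn
  -- The shift raises the first window by one, so `2 * n` now lies above `g a - b > -1` and below `g
  -- a + 2 - b < 2`.
  have hn1 : (-1 : ℝ) < n := by linarith
  have hn2 : (n : ℝ) < 1 := by linarith
  have hn0 : n = 0 := by
    have : (-1 : ℤ) < n := by exact_mod_cast hn1
    have : n < (1 : ℤ) := by exact_mod_cast hn2
    lia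
  rw [hn0, Int.cast_zero, mul_zero, add_zero] at hn
  refine (Γ.g v).le_symm_apply.2 ?_
  linarith

theorem StabilityTilt.posCross {K E : D} (hK : IsTorsionFree tA (transport Φ tB) K)
    (hK0 : ¬ IsZero K) (hE : IsTorsion tA (transport Φ tB) E) (hE0 : ¬ IsZero E) :
    PosCross (charge ZA K) (charge ZA E) := by
  rw [← phaseLT_iff c.left hK.1 hK0 hE.1 hE0]
  filter_upwards [c.phase_torsionFree hK hK0, c.phase_torsion hE hE0] with v h1 h2
  exact h1.trans_lt h2

theorem StabilityTilt.nonnegCross {K E : D} (hK : IsTorsionFree tA (transport Φ tB) K)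
    (hE : IsTorsion tA (transport Φ tB) E) : NonnegCross (charge ZA K) (charge ZA E) := by
  by_cases hK0 : IsZero K
  · rw [charge_of_isZero ZA hK0]
    exact nonnegCross_zero_left _
  by_cases hE0 : IsZero E
  · rw [charge_of_isZero ZA hE0, ← neg_zero, nonnegCross_neg_right]
    exact nonnegCross_zero_left _
  exact (c.posCross hK hK0 hE hE0).nonneg

theorem StabilityTilt.nonnegCross_iff {X Y : D} :
    NonnegCross (charge ZB (Φ.obj X)) (charge ZB (Φ.obj Y)) ↔
      NonnegCross (charge ZA X) (charge ZA Y) := by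
  rw [c.charge_eq, c.charge_eq, nonnegCross_act c.orientation]

theorem StabilityTilt.posCross_iff {X Y : D} :
    PosCross (charge ZB (Φ.obj X)) (charge ZB (Φ.obj Y)) ↔
      PosCross (charge ZA X) (charge ZA Y) := by
  rw [c.charge_eq, c.charge_eq, posCross_act c.orientation]

theorem StabilityTilt.isSemistable_of_nonnegCross [IsTriangulated U] {E : D} (hE : tB.heart (Φ.obj E))
    (h0 : ¬ IsZero E)
    (h : ∀ ⦃P Q : D⦄ (f : P ⟶ E) (g : E ⟶ Q) (δ : Q ⟶ P⟦(1 : ℤ)⟧),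
      Triangle.mk f g δ ∈ distTriang D → (transport Φ tB).heart P → (transport Φ tB).heart Q →
        NonnegCross (charge ZA P) (charge ZA E)) :
    IsSemistable tB b ZB ⟨Φ.obj E, hE⟩ := by
  rw [isSemistable_iff c.right]
  refine ⟨by rwa [isZero_heartCat_iff, isZero_map_iff], fun M N f g δ hT hM hN => ?_⟩
  obtain ⟨P, Q, f', g', δ', hT', ⟨e⟩, ⟨e'⟩⟩ := exists_triangle_preimage Φ hT
  rw [← charge_of_iso ZB e, c.nonnegCross_iff]
  exact h f' g' δ' hT' (tB.heart.prop_of_iso e.symm hM) (tB.heart.prop_of_iso e'.symm hN)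

variable [IsTriangulated D]

/-- If both ends of the torsion sequence of $E$ were nonzero, the torsion subobject would have
strictly larger phase than the torsion-free quotient, contradicting semistability. -/
theorem StabilityTilt.isTorsion_or_isTorsionFree {E : HeartCat tA}
    (hE : IsSemistable tA a ZA E) :
    IsTorsion tA (transport Φ tB) E.obj ∨ IsTorsionFree tA (transport Φ tB) E.obj := by
  rw [isSemistable_iff c.left] at hE
  obtain ⟨P, Q, f, g, δ, hT, hP, hQ⟩ := c.tilt.exists_torsion_triangle E.property
  by_cases hP0 : IsZero P
  · have : IsIso g := (Triangle.isZero₁_iff_isIso₂ _ hT).1 hP0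
    exact Or.inr (hQ.of_iso (asIso g).symm)
  by_cases hQ0 : IsZero Q
  · have : IsIso f := (Triangle.isZero₃_iff_isIso₁ _ hT).1 hQ0
    exact Or.inl (hP.of_iso (asIso f))
  have h1 := hE.2 f g δ hT hP.1 hQ.1
  rw [charge_of_triangle ZA hT, nonnegCross_add_right_self] at h1
  exact absurd (c.posCross hQ hQ0 hP hP0) h1.not_posCross

/-- Let $K[1]\to Q\to R$ be the decomposition of $Q$ and $I$ the kernel of $E\to R$ in $\mathcal A$.
Then $Z(P)=Z(I)+Z(K)$: here $I$ is bounded by semistability of $E$, and $K$, being torsion-free, by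
the cut. -/
theorem StabilityTilt.nonnegCross_of_torsion {E : HeartCat tA} (hE : IsSemistable tA a ZA E)
    (hE' : IsTorsion tA (transport Φ tB) E.obj) {P Q : D} {f : P ⟶ E.obj} {g : E.obj ⟶ Q}
    {δ : Q ⟶ P⟦(1 : ℤ)⟧} (hT : Triangle.mk f g δ ∈ distTriang D)
    (hP : (transport Φ tB).heart P) (hQ : (transport Φ tB).heart Q) :
    NonnegCross (charge ZA P) (charge ZA E.obj) := by
  rw [isSemistable_iff c.left] at hE
  obtain ⟨K, R, k, q, ε, hT', hK, hR⟩ := c.tilt.exists_torsion_triangle' hQ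
  -- The octahedron on $E\to Q\to R$ yields the triangle $P\to I\to K[1]$; together with $I\to E\to
  -- R$ it places $I$ in $\mathcal A$.
  obtain ⟨I, i, j, hI⟩ := distinguished_cocone_triangle₁ (g ≫ q)
  let O := someOctahedron' rfl hT hT' hI
  have hIP := O.mem
  have hE0 := (tA.mem_heart_iff _).1 E.property
  have hR0 := (tA.mem_heart_iff _).1 hR.1
  have hK0 := (tA.mem_heart_iff _).1 hK.1
  have hP0 := c.tilt.isLE_zero ((TStructure.mem_heart_iff _ _).1 hP).1
  have hIheart : tA.heart I := (tA.mem_heart_iff _).2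
    ⟨isLE_middle hIP 0 hP0 (isLE_mono (isLE_shift_of hK0.1 1 (-1)) 0),
      isGE_fibre hI 0 hE0.2 (isGE_mono hR0.2 _)⟩
  have h1 := hE.2 _ _ _ hI hIheart hR.1
  have h2 := charge_of_triangle ZA hIP
  rw [charge_shift, ← sub_eq_add_neg, eq_sub_iff_add_eq] at h2
  rw [← h2]
  exact h1.add_left (c.nonnegCross hK hE')

/-- Dual argument, decomposing the subobject instead: for $S[1]\to P\to R$ one has
$Z(P)=-Z(S)+Z(R)$, where $S$ is a subobject of $E$ in $\mathcal A$ and $R$ is torsion. -/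
theorem StabilityTilt.nonnegCross_of_torsionFree {E : HeartCat tA} (hE : IsSemistable tA a ZA E)
    (hE' : IsTorsionFree tA (transport Φ tB) E.obj) {P Q : D} {f : P ⟶ E.obj⟦(1 : ℤ)⟧}
    {g : E.obj⟦(1 : ℤ)⟧ ⟶ Q} {δ : Q ⟶ P⟦(1 : ℤ)⟧} (hT : Triangle.mk f g δ ∈ distTriang D)
    (hP : (transport Φ tB).heart P) (hQ : (transport Φ tB).heart Q) :
    NonnegCross (charge ZA P) (charge ZA (E.obj⟦(1 : ℤ)⟧)) := by
  rw [isSemistable_iff c.left] at hE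
  obtain ⟨S, R, s, q, ε, hT', hS, hR⟩ := c.tilt.exists_torsion_triangle' hP
  -- The composite $S[1]\to P\to E[1]$ is the shift of some $S\to E$ with cone $J$. The octahedron
  -- gives $R\to J[1]\to Q$, from which the lower bound on $J$ follows.
  obtain ⟨i, hi⟩ := (shiftFunctor D (1 : ℤ)).map_surjective (s ≫ f)
  obtain ⟨J, j, ζ, hJ⟩ := distinguished_cocone_triangle i
  have hJ' := triangle_shift_distinguished hJ
  let O := someOctahedron hi.symm hT' hT hJ'
  have hRJ := O.mem
  have hE0 := (tA.mem_heart_iff _).1 E.property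
  have hR0 := (tA.mem_heart_iff _).1 hR.1
  have hS0 := (tA.mem_heart_iff _).1 hS.1
  have hQ0 := c.tilt.isGE_neg_one ((TStructure.mem_heart_iff _ _).1 hQ).2
  have h3 := isGE_middle hRJ (-1) (isGE_mono hR0.2 _) hQ0
  have hJheart : tA.heart J := (tA.mem_heart_iff _).2
    ⟨isLE_cone hJ 0 (isLE_mono hS0.1 _) hE0.1, tA.isGE_of_shift J 0 1 (-1)⟩
  have h1 := hE.2 _ _ _ hJ hS.1 hJheart
  have h2 := charge_of_triangle ZA hT'
  rw [h2, charge_shift, charge_shift]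
  exact (nonnegCross_neg_neg.2 h1).add_left
    (nonnegCross_neg_right.2 (c.nonnegCross hE' hR))

theorem StabilityTilt.isSemistable_of_torsion [IsTriangulated U] {E : HeartCat tA}
    (hE : IsSemistable tA a ZA E) (hE' : IsTorsion tA (transport Φ tB) E.obj) :
    IsSemistable tB b ZB ⟨Φ.obj E.obj, hE'.2⟩ :=
  c.isSemistable_of_nonnegCross hE'.2 (mt (isZero_heartCat_iff E).2 hE.1)
    fun _ _ _ _ _ => c.nonnegCross_of_torsion hE hE'

theorem StabilityTilt.isSemistable_of_torsionFree [IsTriangulated U] {E : HeartCat tA}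
    (hE : IsSemistable tA a ZA E) (hE' : IsTorsionFree tA (transport Φ tB) E.obj) :
    IsSemistable tB b ZB ⟨Φ.obj (E.obj⟦(1 : ℤ)⟧), hE'.2⟩ :=
  c.isSemistable_of_nonnegCross hE'.2
    (fun h => hE.1 ((isZero_heartCat_iff E).2 (isZero_of_isZero_shift 1 h)))
    fun _ _ _ _ _ => c.nonnegCross_of_torsionFree hE hE'

end Configuration


/-! ### Subquotients in abelian categories -/

section Subquotient

variable {𝒜 : Type*} [Category* 𝒜]

theorem factors_iff_exists {X W : 𝒜} (F : Subobject X) (h : W ⟶ X) :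
    F.Factors h ↔ ∃ k : W ⟶ (F : 𝒜), k ≫ F.arrow = h :=
  ⟨fun hF => ⟨F.factorThru h hF, F.factorThru_arrow h hF⟩,
    fun ⟨k, hk⟩ => hk ▸ Subobject.factors_comp_arrow k⟩

theorem mk_factors_iff_exists {X W A : 𝒜} (m : A ⟶ X) [Mono m] (h : W ⟶ X) :
    (Subobject.mk m).Factors h ↔ ∃ k : W ⟶ A, k ≫ m = h := by
  rw [factors_iff_exists]
  constructor
  · rintro ⟨k, rfl⟩
    exact ⟨k ≫ (Subobject.underlyingIso m).hom, by simp⟩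
  · rintro ⟨k, rfl⟩
    exact ⟨k ≫ (Subobject.underlyingIso m).inv, by simp⟩

variable [Abelian 𝒜]

theorem bot_factors_iff {X W : 𝒜} (h : W ⟶ X) : (⊥ : Subobject X).Factors h ↔ h = 0 :=
  by
  rw [factors_iff_exists, Subobject.bot_arrow]
  exact ⟨fun ⟨k, hk⟩ => by rw [← hk, comp_zero], fun h => ⟨0, by rw [h, comp_zero]⟩⟩

/-- `Q` is a quotient of `G` by the subobject `F`. -/
def IsSubquotient {X : 𝒜} (F G : Subobject X) (Q : 𝒜) : Prop :=
  F ≤ G ∧ ∃ π : (G : 𝒜) ⟶ Q, Epi π ∧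
    ∀ {W : 𝒜} (g : W ⟶ (G : 𝒜)), g ≫ π = 0 ↔ F.Factors (g ≫ G.arrow)

theorem isSubquotient_iff {X : 𝒜} {F G : Subobject X} {Q : 𝒜} (hFG : F ≤ G) :
    IsSubquotient F G Q ↔ ∃ (π : (G : 𝒜) ⟶ Q) (w : Subobject.ofLE F G hFG ≫ π = 0),
      (ShortComplex.mk _ π w).ShortExact := by
  constructor
  · rintro ⟨-, π, hπ, hker⟩
    have w : Subobject.ofLE F G hFG ≫ π = 0 := by
      rw [hker, Subobject.ofLE_arrow]
      exact F.factors_self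
    refine ⟨π, w, ShortComplex.ShortExact.mk' ?_ (inferInstanceAs (Mono (Subobject.ofLE F G hFG)))
      hπ⟩
    refine ShortComplex.exact_of_f_is_kernel _ (KernelFork.IsLimit.ofι _ _
      (fun g hg => F.factorThru (g ≫ G.arrow) ((hker g).1 hg)) (fun g hg => ?_)
      (fun g hg m hm => ?_))
    · rw [← cancel_mono G.arrow, Category.assoc]
      exact (congrArg _ (Subobject.ofLE_arrow hFG)).trans (F.factorThru_arrow _ _)
    · have hm' : m ≫ Subobject.ofLE F G hFG = g := hm
      rw [← cancel_mono F.arrow, F.factorThru_arrow, ← hm', Category.assoc,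
        Subobject.ofLE_arrow]
  · rintro ⟨π, w, hS⟩
    refine ⟨hFG, π, hS.epi_g, fun {W} g => ⟨fun hg => ?_, fun hg => ?_⟩⟩
    · have := hS.mono_f
      have h1 : hS.exact.lift g hg ≫ Subobject.ofLE F G hFG = g := hS.exact.lift_f g hg
      rw [← h1, Category.assoc, Subobject.ofLE_arrow]
      exact Subobject.factors_comp_arrow _
    · have h1 : F.factorThru _ hg ≫ Subobject.ofLE F G hFG = g := by
        rw [← cancel_mono G.arrow, Category.assoc, Subobject.ofLE_arrow, F.factorThru_arrow]
      rw [← h1, Category.assoc, w, comp_zero]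

theorem IsSubquotient.lt {X : 𝒜} {F G : Subobject X} {Q : 𝒜} (h : IsSubquotient F G Q)
    (hQ : ¬ IsZero Q) : F < G := by
  refine h.1.lt_of_ne fun he => hQ ?_
  obtain ⟨-, π, hπ, hker⟩ := h
  have h0 : 𝟙 (G : 𝒜) ≫ π = 0 := (hker _).2 (by rw [he]; exact Subobject.factors_comp_arrow _)
  rw [IsZero.iff_id_eq_zero, ← cancel_epi π, comp_zero, Category.comp_id, ← h0, Category.id_comp]

theorem isSubquotient_mk {X : 𝒜} {S : ShortComplex 𝒜} (hS : S.ShortExact) (m : S.X₂ ⟶ X)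
    [Mono m] (m' : S.X₁ ⟶ X) [Mono m'] (hm : S.f ≫ m = m') :
    IsSubquotient (Subobject.mk m') (Subobject.mk m) S.X₃ := by
  have := hS.mono_f
  have := hS.epi_g
  refine ⟨Subobject.mk_le_mk_of_comm S.f hm, (Subobject.underlyingIso m).hom ≫ S.g,
    inferInstance, fun {W} g => ?_⟩
  rw [mk_factors_iff_exists, ← hm]
  constructor
  · intro hg
    rw [← Category.assoc] at hg
    exact ⟨hS.exact.lift _ hg, by
      rw [← Category.assoc, hS.exact.lift_f, Category.assoc, Subobject.underlyingIso_hom_comp_eq_mk]⟩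
  · rintro ⟨k, hk⟩
    have h1 : k ≫ S.f = g ≫ (Subobject.underlyingIso m).hom := by
      rw [← cancel_mono m, Category.assoc, hk, Category.assoc,
        Subobject.underlyingIso_hom_comp_eq_mk]
    rw [← Category.assoc, ← h1, Category.assoc, S.zero, comp_zero]

/-- The image of a subobject under a monomorphism. -/
noncomputable def pushforward {M X : 𝒜} (i : M ⟶ X) [Mono i] (F : Subobject M) : Subobject X :=
  Subobject.mk (F.arrow ≫ i)

theorem pushforward_bot {M X : 𝒜} (i : M ⟶ X) [Mono i] : pushforward i ⊥ = ⊥ := by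
  rw [pushforward, Subobject.mk_eq_bot_iff_zero, Subobject.bot_arrow, zero_comp]

theorem IsSubquotient.pushforward {M X : 𝒜} (i : M ⟶ X) [Mono i] {F G : Subobject M} {Q : 𝒜}
    (h : IsSubquotient F G Q) : IsSubquotient (pushforward i F) (pushforward i G) Q := by
  obtain ⟨π, w, hS⟩ := (isSubquotient_iff h.1).1 h
  exact isSubquotient_mk hS (G.arrow ≫ i) (F.arrow ≫ i) (by simp)

theorem pullback_factors_iff {X N W : 𝒜} (q : X ⟶ N) (F : Subobject N) (h : W ⟶ X) :
    ((Subobject.pullback q).obj F).Factors h ↔ F.Factors (h ≫ q) := by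
  have hp := Subobject.isPullback q F
  constructor
  · intro hF
    rw [← Subobject.factorThru_arrow _ _ hF, Category.assoc, ← hp.w, ← Category.assoc]
    exact Subobject.factors_comp_arrow _
  · intro hF
    have := hp.lift_snd (F.factorThru _ hF) h (F.factorThru_arrow _ hF)
    rw [← this]
    exact Subobject.factors_comp_arrow _

theorem epi_pullbackπ {X N : 𝒜} (q : X ⟶ N) [Epi q] (F : Subobject N) :
    Epi (Subobject.pullbackπ q F) :=
  Abelian.epi_fst_of_isLimit _ _ (Subobject.isPullback q F).isLimit

theorem IsSubquotient.pullback {X N : 𝒜} (q : X ⟶ N) [Epi q] {F G : Subobject N} {Q : 𝒜}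
    (h : IsSubquotient F G Q) :
    IsSubquotient ((Subobject.pullback q).obj F) ((Subobject.pullback q).obj G) Q := by
  obtain ⟨hFG, π, hπ, hker⟩ := h
  have := epi_pullbackπ q G
  refine ⟨(Subobject.pullback q).monotone hFG, Subobject.pullbackπ q G ≫ π,
    inferInstance, fun {W} g => ?_⟩
  rw [← Category.assoc, hker, pullback_factors_iff, Category.assoc, Category.assoc,
    (Subobject.isPullback q G).w]

/-- The seam of the concatenation: the step at index $k$ is both the last one from the subobject and
the first one from the quotient. -/
theorem pushforward_top_eq_pullback_bot {S : ShortComplex 𝒜} (hS : S.ShortExact) [Mono S.f] :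
    pushforward S.f ⊤ = (Subobject.pullback S.g).obj ⊥ := by
  refine le_antisymm (Subobject.le_of_factors ?_) (Subobject.le_of_factors ?_)
  · rw [pullback_factors_iff, bot_factors_iff, pushforward,
      ← Subobject.underlyingIso_hom_comp_eq_mk, Category.assoc, Category.assoc, S.zero,
      comp_zero, comp_zero]
  · have h := Subobject.factors_self ((Subobject.pullback S.g).obj ⊥)
    rw [pullback_factors_iff, bot_factors_iff] at h
    rw [pushforward, mk_factors_iff_exists]
    exact ⟨hS.exact.lift _ h ≫ inv (⊤ : Subobject S.X₁).arrow, by simp⟩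

/-- An extension of a subobject of the quotient, mapping compatibly to the middle term, is the
preimage of that subobject. -/
theorem exists_iso_pullback {S S' : ShortComplex 𝒜} (hS : S.ShortExact) (hS' : S'.ShortExact)
    (F : Subobject S.X₃) (e₁ : S'.X₁ ≅ S.X₁) (e₃ : S'.X₃ ≅ (F : 𝒜)) (n : S'.X₂ ⟶ S.X₂)
    (h₁ : S'.f ≫ n = e₁.hom ≫ S.f) (h₂ : n ≫ S.g = S'.g ≫ e₃.hom ≫ F.arrow) :
    ∃ e : (((Subobject.pullback S.g).obj F : Subobject S.X₂) : 𝒜) ≅ S'.X₂,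
      e.hom ≫ n = ((Subobject.pullback S.g).obj F).arrow := by
  have := hS.mono_f
  have := hS.epi_g
  have hp := Subobject.isPullback S.g F
  set P := (Subobject.pullback S.g).obj F
  have hepi := epi_pullbackπ S.g F
  set π := Subobject.pullbackπ S.g F
  let l : S.X₁ ⟶ (P : 𝒜) := hp.lift 0 S.f (by simp)
  have hl : l ≫ P.arrow = S.f := hp.lift_snd _ _ _
  have hlπ : l ≫ π = 0 := hp.lift_fst _ _ _
  have hlm : Mono l := mono_of_mono_fac hl
  -- The pullback is itself an extension of `F` by `S.X₁`; the universal property maps `S'` to it,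
  -- isomorphically at both ends, so the middle map is an isomorphism.
  let S₂ : ShortComplex 𝒜 := ShortComplex.mk l π hlπ
  have hS₂ : S₂.ShortExact := by
    refine ShortComplex.ShortExact.mk' ?_ hlm hepi
    have hk : ∀ {W : 𝒜} (g : W ⟶ (P : 𝒜)), g ≫ π = 0 → (g ≫ P.arrow) ≫ S.g = 0 := by
      intro W g hg
      rw [Category.assoc, ← hp.w, ← Category.assoc, hg, zero_comp]
    refine ShortComplex.exact_of_f_is_kernel _ (KernelFork.IsLimit.ofι _ _
      (fun g hg => hS.exact.lift (g ≫ P.arrow) (hk g hg)) (fun g hg => ?_) (fun g hg m hm => ?_))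
    · rw [← cancel_mono P.arrow, Category.assoc]
      exact (congrArg _ hl).trans (hS.exact.lift_f _ _)
    · have hm' : m ≫ l = g := hm
      rw [← cancel_mono S.f, hS.exact.lift_f, ← hm', Category.assoc, hl]
  let m₂ : S'.X₂ ⟶ (P : 𝒜) := hp.lift (S'.g ≫ e₃.hom) n (by rw [Category.assoc, h₂])
  have hm₁ : m₂ ≫ π = S'.g ≫ e₃.hom := hp.lift_fst _ _ _
  have hm₂ : m₂ ≫ P.arrow = n := hp.lift_snd _ _ _
  let φ : S' ⟶ S₂ :=
    { τ₁ := e₁.hom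
      τ₂ := m₂
      τ₃ := e₃.hom
      comm₁₂ := by
        change e₁.hom ≫ l = S'.f ≫ m₂
        rw [← cancel_mono P.arrow, Category.assoc, Category.assoc, hl, hm₂, h₁]
      comm₂₃ := hm₁ }
  have h1 : IsIso φ.τ₁ := inferInstanceAs (IsIso e₁.hom)
  have h3 : IsIso φ.τ₃ := inferInstanceAs (IsIso e₃.hom)
  have h2 : IsIso m₂ := ShortComplex.isIso₂_of_shortExact_of_isIso₁₃ φ hS' hS₂
  exact ⟨(asIso m₂).symm, by rw [Iso.symm_hom, asIso_inv, IsIso.inv_comp_eq, hm₂]⟩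

/-- The concatenation of a filtration of `M` and one of `N` for `0 → M → X → N → 0`. -/
noncomputable def concatenate {M X N : 𝒜} (i : M ⟶ X) [Mono i] (q : X ⟶ N) {k l : ℕ}
    (FM : Fin (k + 1) → Subobject M) (FN : Fin (l + 1) → Subobject N) :
    Fin (k + l + 1) → Subobject X := fun n =>
  if h : n.1 ≤ k then pushforward i (FM ⟨n.1, by omega⟩)
  else (Subobject.pullback q).obj (FN ⟨n.1 - k, by omega⟩)

theorem concatenate_left {M X N : 𝒜} (i : M ⟶ X) [Mono i] (q : X ⟶ N) {k l : ℕ}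
    (FM : Fin (k + 1) → Subobject M) (FN : Fin (l + 1) → Subobject N) (n : Fin (k + 1)) :
    concatenate i q FM FN ⟨n, by omega⟩ = pushforward i (FM n) :=
  dif_pos (Nat.lt_succ_iff.1 n.2)

theorem concatenate_right {S : ShortComplex 𝒜} (hS : S.ShortExact) [Mono S.f] {k l : ℕ}
    (FM : Fin (k + 1) → Subobject S.X₁) (FN : Fin (l + 1) → Subobject S.X₃)
    (hM : FM (Fin.last k) = ⊤) (hN : FN 0 = ⊥) (n : Fin (l + 1)) :
    concatenate S.f S.g FM FN ⟨k + n, by omega⟩ = (Subobject.pullback S.g).obj (FN n) := by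
  by_cases hn : n = 0
  · subst hn
    rw [hN, ← pushforward_top_eq_pullback_bot hS, ← hM]
    exact concatenate_left _ _ FM FN (Fin.last k)
  · have h0 : n.1 ≠ 0 := fun h => hn (Fin.ext h)
    rw [concatenate, dif_neg (by simp only; omega)]
    congr 2
    exact Fin.ext (by simp)

end Subquotient

/-! ### Concatenation of Harder-Narasimhan filtrations -/

section HN

variable {C : Type*} [Category* C] [Preadditive C] [HasZeroObject C] [HasShift C ℤ]
  [∀ n : ℤ, (shiftFunctor C n).Additive] [Pretriangulated C] [IsTriangulated C]
  {t : TStructure C}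

/-- The filtration `F` is a Harder-Narasimhan filtration with successive quotients `Q`. -/
structure IsHNFiltrationWith (t : TStructure C) (a : ℝ → ℝ) (Z : K₀ C →+ CLaurent)
    {E : HeartCat t} {m : ℕ} (F : Fin (m + 1) → Subobject E) (Q : Fin m → HeartCat t) : Prop where
  zero : F 0 = ⊥
  last : F (Fin.last m) = ⊤
  quotient : ∀ i, IsSubquotient (F i.castSucc) (F i.succ) (Q i)
  semistable : ∀ i, IsSemistable t a Z (Q i)
  phase_lt : ∀ i j, i < j → PhaseLT (phase a Z (Q j).obj) (phase a Z (Q i).obj)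

theorem isZero_subobject_iff {𝒜 : Type*} [Category* 𝒜] [Abelian 𝒜] {X : 𝒜} (F : Subobject X) :
    IsZero (F : 𝒜) ↔ F = ⊥ := by
  rw [← Subobject.mk_arrow F, Subobject.mk_eq_bot_iff_zero, Subobject.mk_arrow]
  constructor
  · exact fun h => h.eq_of_src _ _
  · intro h
    rw [IsZero.iff_id_eq_zero, ← cancel_mono F.arrow, h, comp_zero, comp_zero]

theorem isHNFiltration_iff {a : ℝ → ℝ} {Z : K₀ C →+ CLaurent} {E : HeartCat t} {m : ℕ}
    {F : Fin (m + 1) → Subobject E} :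
    IsHNFiltration t a Z F ↔ ∃ Q : Fin m → HeartCat t, IsHNFiltrationWith t a Z F Q := by
  constructor
  · rintro ⟨hF, h0, h1, Q, π, w, hS, hss, hφ⟩
    exact ⟨Q, (isZero_subobject_iff _).1 h0, h1, fun i =>
      (isSubquotient_iff (hF i.castSucc_lt_succ).le).2 ⟨π i, w i, hS i⟩, hss, hφ⟩
  · rintro ⟨Q, h0, h1, hq, hss, hφ⟩
    have hF : StrictMono F := Fin.strictMono_iff_lt_succ.2 fun i => (hq i).lt (hss i).1
    choose π w hS using fun i => (isSubquotient_iff (hF i.castSucc_lt_succ).le).1 (hq i)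
    exact ⟨hF, (isZero_subobject_iff _).2 h0, h1, Q, π, w, hS, hss, hφ⟩

theorem IsHNFiltrationWith.concatenate {a : ℝ → ℝ} {Z : K₀ C →+ CLaurent}
    {S : ShortComplex (HeartCat t)} (hS : S.ShortExact) [Mono S.f] {k l : ℕ}
    {FM : Fin (k + 1) → Subobject S.X₁} {FN : Fin (l + 1) → Subobject S.X₃}
    {QM : Fin k → HeartCat t} {QN : Fin l → HeartCat t}
    (hM : IsHNFiltrationWith t a Z FM QM) (hN : IsHNFiltrationWith t a Z FN QN)
    (hlt : ∀ i j, PhaseLT (phase a Z (QN j).obj) (phase a Z (QM i).obj)) :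
    IsHNFiltrationWith t a Z (concatenate S.f S.g FM FN) (Fin.append QM QN) := by
  have := hS.epi_g
  have hr := concatenate_right hS FM FN hM.last hN.zero
  refine ⟨?_, ?_, fun i => ?_, fun i => ?_, fun i j hij => ?_⟩
  · have h0 := concatenate_left S.f S.g FM FN 0
    rw [hM.zero, pushforward_bot] at h0
    exact h0
  · have h0 := hr (Fin.last l)
    rw [hN.last, Subobject.pullback_top] at h0
    exact h0
  · induction i using Fin.addCases with
    | left i =>
      rw [Fin.append_left]
      have h1 := concatenate_left S.f S.g FM FN i.castSucc
      have h2 := concatenate_left S.f S.g FM FN i.succ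
      have h3 := (hM.quotient i).pushforward S.f
      rw [← h1, ← h2] at h3
      exact h3
    | right i =>
      rw [Fin.append_right]
      have h3 := (hN.quotient i).pullback S.g
      rw [← hr, ← hr] at h3
      exact h3
  · induction i using Fin.addCases with
    | left i => rw [Fin.append_left]; exact hM.semistable i
    | right i => rw [Fin.append_right]; exact hN.semistable i
  · induction i using Fin.addCases with
    | left i =>
      induction j using Fin.addCases with
      | left j => rw [Fin.append_left, Fin.append_left]; exact hM.phase_lt i j hij
      | right j => rw [Fin.append_left, Fin.append_right]; exact hlt i j
    | right i =>
      induction j using Fin.addCases with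
      | left j =>
        exfalso
        have : (Fin.natAdd k i).1 < (Fin.castAdd l j).1 := hij
        simp only [Fin.val_natAdd, Fin.val_castAdd] at this
        omega
      | right j =>
        rw [Fin.append_right, Fin.append_right]
        refine hN.phase_lt i j ?_
        have : (Fin.natAdd k i).1 < (Fin.natAdd k j).1 := hij
        simp only [Fin.val_natAdd] at this
        exact Fin.lt_def.2 (by omega)

end HN


/-! ### Images of Harder-Narasimhan filtrations under functors -/

section Image

variable {D : Type*} [Category* D] [Preadditive D] [HasZeroObject D] [HasShift D ℤ]
  [∀ n : ℤ, (shiftFunctor D n).Additive] [Pretriangulated D]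
  {U : Type*} [Category* U] [Preadditive U] [HasZeroObject U] [HasShift U ℤ]
  [∀ n : ℤ, (shiftFunctor U n).Additive] [Pretriangulated U]

/-- `G` sends distinguished triangles to distinguished triangles, for some connecting morphism. -/
def PreservesTriangles (G : D ⥤ U) : Prop :=
  ∀ ⦃X Y W : D⦄ (f : X ⟶ Y) (g : Y ⟶ W) (h : W ⟶ X⟦(1 : ℤ)⟧), Triangle.mk f g h ∈ distTriang D →
    ∃ h' : G.obj W ⟶ (G.obj X)⟦(1 : ℤ)⟧, Triangle.mk (G.map f) (G.map g) h' ∈ distTriang U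

variable [IsTriangulated D] [IsTriangulated U] {tA : TStructure D} {tB : TStructure U}

/-- `G` need not map the whole heart of `tA` into that of `tB`, so there is no exact functor of
hearts to apply. That the images of the steps are subobjects in the heart of `tB` is deduced from
the factors and from the triangles they form. -/
theorem IsHNFiltrationWith.exists_map (G : D ⥤ U) [G.PreservesZeroMorphisms]
    (hG : PreservesTriangles G) {a b : ℝ → ℝ} {ZA : K₀ D →+ CLaurent} {ZB : K₀ U →+ CLaurent}
    {M : HeartCat tA} {m : ℕ} {F : Fin (m + 1) → Subobject M} {Q : Fin m → HeartCat tA}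
    (hF : IsHNFiltrationWith tA a ZA F Q) (hM : tB.heart (G.obj M.obj))
    (hQ : ∀ i, tB.heart (G.obj (Q i).obj))
    (hss : ∀ i, IsSemistable tB b ZB ⟨G.obj (Q i).obj, hQ i⟩)
    (hφ : ∀ i j, i < j →
      PhaseLT (phase b ZB (G.obj (Q j).obj)) (phase b ZB (G.obj (Q i).obj))) :
    ∃ F' : Fin (m + 1) → Subobject (⟨G.obj M.obj, hM⟩ : HeartCat tB),
      IsHNFiltrationWith tB b ZB F' (fun i => ⟨G.obj (Q i).obj, hQ i⟩) ∧
      ∀ i, ∃ e : (F' i : HeartCat tB).obj ≅ G.obj (F i : HeartCat tA).obj,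
        e.hom ≫ G.map (tA.heart.ι.map (F i).arrow) = tB.heart.ι.map (F' i).arrow := by
  choose π w hS using fun i => (isSubquotient_iff (hF.quotient i).1).1 (hF.quotient i)
  choose δ hT using fun i => exists_triangle_of_shortExact (hS i)
  choose ε hT' using fun i => hG _ _ _ (hT i)
  -- Upwards: each step is an extension of a factor by the preceding step.
  have hheart : ∀ i, tB.heart (G.obj (F i : HeartCat tA).obj) := by
    intro i
    induction i using Fin.induction with
    | zero =>
      have h0 := (isZero_heartCat_iff _).1 ((isZero_subobject_iff _).2 hF.zero)
      exact heart_of_isZero tB (G.map_isZero h0)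
    | succ i ih => exact heart_middle (hT' i) ih (hQ i)
  let A : Fin (m + 1) → HeartCat tB := fun i => ⟨G.obj (F i : HeartCat tA).obj, hheart i⟩
  let j : ∀ i, A i ⟶ (⟨G.obj M.obj, hM⟩ : HeartCat tB) := fun i =>
    ObjectProperty.homMk (G.map (tA.heart.ι.map (F i).arrow))
  let f : ∀ i : Fin m, A i.castSucc ⟶ A i.succ := fun i =>
    ObjectProperty.homMk (G.map (tA.heart.ι.map (Subobject.ofLE _ _ (hF.quotient i).1)))
  let g : ∀ i : Fin m, A i.succ ⟶ (⟨G.obj (Q i).obj, hQ i⟩ : HeartCat tB) := fun i =>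
    ObjectProperty.homMk (G.map (tA.heart.ι.map (π i)))
  have hfj : ∀ i, f i ≫ j i.succ = j i.castSucc := by
    intro i
    apply tB.heart.ι.map_injective
    change G.map (tA.heart.ι.map _) ≫ G.map (tA.heart.ι.map _) = G.map (tA.heart.ι.map _)
    rw [← Functor.map_comp, ← Functor.map_comp, Subobject.ofLE_arrow]
  choose w' hS' using fun i => shortExact_of_triangle (f i) (g i) (ε i) (hT' i)
  -- Downwards: the last inclusion is an isomorphism, and each earlier one is a monomorphism
  -- followed by the next inclusion.
  have hmono : ∀ i, Mono (j i) := by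
    intro i
    induction i using Fin.reverseInduction with
    | last =>
      have h1 : IsIso (F (Fin.last m)).arrow := by rw [hF.last]; infer_instance
      have h2 : IsIso (tB.heart.ι.map (j (Fin.last m))) :=
        inferInstanceAs (IsIso (G.map (tA.heart.ι.map (F (Fin.last m)).arrow)))
      have h3 : IsIso (j (Fin.last m)) := isIso_of_reflects_iso _ tB.heart.ι
      infer_instance
    | cast i ih =>
      have := (hS' i).mono_f
      have h1 : Mono (f i) := this
      rw [← hfj]
      infer_instance
  refine ⟨fun i => Subobject.mk (j i), ⟨?_, ?_, fun i => ?_, hss, hφ⟩, fun i => ?_⟩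
  · have h0 := (isZero_heartCat_iff _).1 ((isZero_subobject_iff _).2 hF.zero)
    have h1 : IsZero (A 0) := (isZero_heartCat_iff _).2 (G.map_isZero h0)
    rw [Subobject.mk_eq_bot_iff_zero]
    exact h1.eq_of_src _ _
  · have h1 : IsIso (F (Fin.last m)).arrow := by rw [hF.last]; infer_instance
    have h2 : IsIso (tB.heart.ι.map (j (Fin.last m))) :=
      inferInstanceAs (IsIso (G.map (tA.heart.ι.map (F (Fin.last m)).arrow)))
    have h3 : IsIso (j (Fin.last m)) := isIso_of_reflects_iso _ tB.heart.ι
    exact Subobject.mk_eq_top_of_isIso _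
  · exact isSubquotient_mk (hS' i) (j i.succ) (j i.castSucc) (hfj i)
  · refine ⟨tB.heart.ι.mapIso (Subobject.underlyingIso (j i)), ?_⟩
    have := congrArg tB.heart.ι.map (Subobject.underlyingIso_hom_comp_eq_mk (j i))
    rw [Functor.map_comp] at this
    exact this

end Image


/-! ### Harder-Narasimhan filtrations in the tilted heart -/

section Tilted

variable {D : Type*} [Category* D] [Preadditive D] [HasZeroObject D] [HasShift D ℤ]
  [∀ n : ℤ, (shiftFunctor D n).Additive] [Pretriangulated D]
  {U : Type*} [Category* U] [Preadditive U] [HasZeroObject U] [HasShift U ℤ]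
  [∀ n : ℤ, (shiftFunctor U n).Additive] [Pretriangulated U]
  {Φ : D ⥤ U} [Φ.CommShift ℤ] [Φ.IsTriangulated]

variable (Φ) in
theorem preservesTriangles_of_isTriangulated : PreservesTriangles Φ :=
  fun _ _ _ _ _ _ hT => ⟨_, map_triangle_distinguished Φ hT⟩

variable (Φ) in
theorem preservesTriangles_shift_comp : PreservesTriangles (shiftFunctor D (1 : ℤ) ⋙ Φ) :=
  fun _ _ _ _ _ _ hT => ⟨_, map_triangle_distinguished Φ (triangle_shift_distinguished hT)⟩

/-- Base change of a distinguished triangle along a morphism to its third vertex. -/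
theorem exists_triangle_of_hom₃ {X Y W W' : D} {u : X ⟶ Y} {p : Y ⟶ W} {w : W ⟶ X⟦(1 : ℤ)⟧}
    (hT : Triangle.mk u p w ∈ distTriang D) (s : W' ⟶ W) :
    ∃ (L : D) (n : L ⟶ Y) (x : X ⟶ L) (y : L ⟶ W'),
      Triangle.mk x y (s ≫ w) ∈ distTriang D ∧ x ≫ n = u ∧ n ≫ p = y ≫ s := by
  obtain ⟨L, x, y, hL⟩ := distinguished_cocone_triangle₂ (s ≫ w)
  obtain ⟨n, hn₁, hn₂⟩ := complete_distinguished_triangle_morphism₂ _ _ hL hT (𝟙 X) s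
    (by change (s ≫ w) ≫ (𝟙 X)⟦(1 : ℤ)⟧' = s ≫ w; rw [CategoryTheory.Functor.map_id, Category.comp_id])
  exact ⟨L, n, x, y, hL, hn₁.trans (Category.id_comp u), hn₂.symm⟩

variable [Φ.IsEquivalence] [IsTriangulated D] {tA : TStructure D} {tB : TStructure U} {a b : ℝ → ℝ}
  {ZA : K₀ D →+ CLaurent} {ZB : K₀ U →+ CLaurent} {T : GL (Fin 2) RLaurent} {Γ : LiftedPath T}
  (c : StabilityTilt Φ tA tB a b ZA ZB Γ)

include c

theorem StabilityTilt.not_isTorsion_of_lt {m : ℕ} {E : HeartCat tA}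
    {F : Fin (m + 1) → Subobject E} {Q : Fin m → HeartCat tA}
    (hF : IsHNFiltrationWith tA a ZA F Q) {i j : Fin m} (hij : i < j)
    (hi : IsTorsionFree tA (transport Φ tB) (Q i).obj) :
    ¬ IsTorsion tA (transport Φ tB) (Q j).obj := by
  intro hj
  have h0 := fun i => mt (isZero_heartCat_iff (Q i)).2 (hF.semistable i).1
  have h1 := hF.phase_lt i j hij
  rw [phaseLT_iff c.left (Q j).property (h0 j) (Q i).property (h0 i)] at h1
  exact h1.not_posCross (c.posCross hi (h0 i) hj (h0 j))

/-- The first factor is a nonzero subobject of a torsion-free object, hence not torsion, hence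
torsion-free. The later factors have smaller phase and cannot be torsion. -/
theorem StabilityTilt.quotient_isTorsionFree {m : ℕ} {M : HeartCat tA}
    {F : Fin (m + 1) → Subobject M} {Q : Fin m → HeartCat tA}
    (hF : IsHNFiltrationWith tA a ZA F Q) (hM : IsTorsionFree tA (transport Φ tB) M.obj)
    (i : Fin m) : IsTorsionFree tA (transport Φ tB) (Q i).obj := by
  obtain _ | m := m
  · exact i.elim0
  have h0 : IsTorsionFree tA (transport Φ tB) (Q 0).obj := by
    refine (c.isTorsion_or_isTorsionFree (hF.semistable 0)).resolve_left fun hQ => ?_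
    obtain ⟨-, π, hπ, hker⟩ := hF.quotient 0
    -- As `F 0` is zero, the first quotient map is an isomorphism and `Q 0` embeds in `M`.
    have hm : Mono π := Preadditive.mono_of_cancel_zero _ fun g hg => by
      have h1 := (hker g).1 hg
      rw [Fin.castSucc_zero, hF.zero, bot_factors_iff] at h1
      exact zero_of_comp_mono _ h1
    have hi : IsIso π := isIso_of_mono_of_epi π
    have hz : inv π ≫ (F (Fin.succ 0)).arrow = 0 :=
      tA.heart.ι.map_injective (hQ.hom_eq_zero hM _)
    refine (hF.semistable 0).1 ?_
    rw [IsZero.iff_id_eq_zero, ← cancel_mono (inv π ≫ (F (Fin.succ 0)).arrow), hz, comp_zero,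
      comp_zero]
  rcases eq_or_ne i 0 with rfl | hi
  · exact h0
  · exact (c.isTorsion_or_isTorsionFree (hF.semistable i)).resolve_left
      (c.not_isTorsion_of_lt hF (Fin.pos_iff_ne_zero.2 hi) h0)

/-- Dually, the last factor is a nonzero quotient of a torsion object, and the earlier factors have
larger phase. -/
theorem StabilityTilt.quotient_isTorsion {m : ℕ} {N : HeartCat tA}
    {F : Fin (m + 1) → Subobject N} {Q : Fin m → HeartCat tA}
    (hF : IsHNFiltrationWith tA a ZA F Q) (hN : IsTorsion tA (transport Φ tB) N.obj)
    (i : Fin m) : IsTorsion tA (transport Φ tB) (Q i).obj := by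
  obtain _ | m := m
  · exact i.elim0
  have h0 : IsTorsion tA (transport Φ tB) (Q (Fin.last m)).obj := by
    refine (c.isTorsion_or_isTorsionFree (hF.semistable (Fin.last m))).resolve_right fun hQ => ?_
    obtain ⟨-, π, hπ, -⟩ := hF.quotient (Fin.last m)
    have hi : IsIso (F (Fin.last m).succ).arrow := by
      rw [Fin.succ_last, hF.last]
      infer_instance
    have hz : inv (F (Fin.last m).succ).arrow ≫ π = 0 :=
      tA.heart.ι.map_injective (hN.hom_eq_zero hQ _)
    refine (hF.semistable (Fin.last m)).1 ?_
    rw [IsZero.iff_id_eq_zero, ← cancel_epi (inv (F (Fin.last m).succ).arrow ≫ π), hz, zero_comp,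
      zero_comp]
  rcases eq_or_ne i (Fin.last m) with rfl | hi
  · exact h0
  · exact (c.isTorsion_or_isTorsionFree (hF.semistable i)).resolve_right fun h =>
      c.not_isTorsion_of_lt hF (Fin.lt_last_iff_ne_last.2 hi) h h0

variable [IsTriangulated U]

theorem StabilityTilt.exists_map_of_torsionFree {m : ℕ} {M : HeartCat tA}
    {F : Fin (m + 1) → Subobject M} {Q : Fin m → HeartCat tA}
    (hF : IsHNFiltrationWith tA a ZA F Q) (hM : IsTorsionFree tA (transport Φ tB) M.obj) :
    ∃ F' : Fin (m + 1) → Subobject (⟨Φ.obj (M.obj⟦(1 : ℤ)⟧), hM.2⟩ : HeartCat tB),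
      IsHNFiltrationWith tB b ZB F' (fun i => ⟨Φ.obj ((Q i).obj⟦(1 : ℤ)⟧),
        (c.quotient_isTorsionFree hF hM i).2⟩) ∧
      ∀ i, ∃ e : (F' i : HeartCat tB).obj ≅ Φ.obj ((F i : HeartCat tA).obj⟦(1 : ℤ)⟧),
        e.hom ≫ Φ.map ((tA.heart.ι.map (F i).arrow)⟦(1 : ℤ)⟧') = tB.heart.ι.map (F' i).arrow := by
  have hQ := c.quotient_isTorsionFree hF hM
  have hss := fun i => c.isSemistable_of_torsionFree (hF.semistable i) (hQ i)
  refine hF.exists_map (shiftFunctor D (1 : ℤ) ⋙ Φ) (preservesTriangles_shift_comp Φ) hM.2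
    (fun i => (hQ i).2) hss fun i j hij => ?_
  have h0 := fun i => mt (isZero_heartCat_iff (Q i)).2 (hF.semistable i).1
  have h0' := fun i => mt (isZero_heartCat_iff _).2 (hss i).1
  have h1 := hF.phase_lt i j hij
  rw [phaseLT_iff c.left (Q j).property (h0 j) (Q i).property (h0 i)] at h1
  refine (phaseLT_iff c.right (hQ j).2 (h0' j) (hQ i).2 (h0' i)).2 (c.posCross_iff.2 ?_)
  rwa [charge_shift, charge_shift, posCross_neg_neg]

theorem StabilityTilt.exists_map_of_torsion {m : ℕ} {N : HeartCat tA}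
    {F : Fin (m + 1) → Subobject N} {Q : Fin m → HeartCat tA}
    (hF : IsHNFiltrationWith tA a ZA F Q) (hN : IsTorsion tA (transport Φ tB) N.obj) :
    ∃ F' : Fin (m + 1) → Subobject (⟨Φ.obj N.obj, hN.2⟩ : HeartCat tB),
      IsHNFiltrationWith tB b ZB F' (fun i => ⟨Φ.obj (Q i).obj,
        (c.quotient_isTorsion hF hN i).2⟩) ∧
      ∀ i, ∃ e : (F' i : HeartCat tB).obj ≅ Φ.obj (F i : HeartCat tA).obj,
        e.hom ≫ Φ.map (tA.heart.ι.map (F i).arrow) = tB.heart.ι.map (F' i).arrow := by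
  have hQ := c.quotient_isTorsion hF hN
  have hss := fun i => c.isSemistable_of_torsion (hF.semistable i) (hQ i)
  refine hF.exists_map Φ (preservesTriangles_of_isTriangulated Φ) hN.2
    (fun i => (hQ i).2) hss fun i j hij => ?_
  have h0 := fun i => mt (isZero_heartCat_iff (Q i)).2 (hF.semistable i).1
  have h0' := fun i => mt (isZero_heartCat_iff _).2 (hss i).1
  have h1 := hF.phase_lt i j hij
  rw [phaseLT_iff c.left (Q j).property (h0 j) (Q i).property (h0 i)] at h1
  exact (phaseLT_iff c.right (hQ j).2 (h0' j) (hQ i).2 (h0' i)).2 (c.posCross_iff.2 h1)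

/-- Filtrations of the two cohomology objects of an object of the tilted heart are concatenated to
a filtration of that object. -/
theorem StabilityTilt.exists_concatenation {X : HeartCat tB} {Y : D} (r : Φ.obj Y ≅ X.obj)
    {M N : HeartCat tA} {u : M.obj⟦(1 : ℤ)⟧ ⟶ Y} {p : Y ⟶ N.obj}
    {w : N.obj ⟶ (M.obj⟦(1 : ℤ)⟧)⟦(1 : ℤ)⟧} (hT : Triangle.mk u p w ∈ distTriang D) {k l : ℕ}
    {FM : Fin (k + 1) → Subobject M} {FN : Fin (l + 1) → Subobject N}
    (hFM : IsHNFiltration tA a ZA FM) (hFN : IsHNFiltration tA a ZA FN) :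
    ∃ FX : Fin (k + l + 1) → Subobject X, IsHNFiltration tB b ZB FX ∧
      (∀ i : Fin (k + 1), ∃ e : (FX ⟨i, by omega⟩ : HeartCat tB).obj ≅
          Φ.obj ((FM i : HeartCat tA).obj⟦(1 : ℤ)⟧),
        e.hom ≫ Φ.map ((tA.heart.ι.map (FM i).arrow)⟦(1 : ℤ)⟧' ≫ u) ≫ r.hom =
          tB.heart.ι.map (FX ⟨i, by omega⟩).arrow) ∧
      ∀ j : Fin (l + 1), ∃ (L : D) (n : L ⟶ Y) (x : M.obj⟦(1 : ℤ)⟧ ⟶ L)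
        (y : L ⟶ (FN j : HeartCat tA).obj)
        (z : (FN j : HeartCat tA).obj ⟶ (M.obj⟦(1 : ℤ)⟧)⟦(1 : ℤ)⟧),
        Triangle.mk x y z ∈ distTriang D ∧ x ≫ n = u ∧ n ≫ p = y ≫ tA.heart.ι.map (FN j).arrow ∧
          z = tA.heart.ι.map (FN j).arrow ≫ w ∧
          ∃ e : (FX ⟨k + j, by omega⟩ : HeartCat tB).obj ≅ Φ.obj L,
            e.hom ≫ Φ.map n ≫ r.hom = tB.heart.ι.map (FX ⟨k + j, by omega⟩).arrow := by
  obtain ⟨QM, hFM⟩ := isHNFiltration_iff.1 hFM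
  obtain ⟨QN, hFN⟩ := isHNFiltration_iff.1 hFN
  obtain ⟨hM, hN⟩ := c.tilt.isTorsionFree_and_isTorsion hT
    (tB.heart.prop_of_iso r.symm X.property) M.property N.property
  have hQM := c.quotient_isTorsionFree hFM hM
  have hQN := c.quotient_isTorsion hFN hN
  obtain ⟨FM', hFM', eM⟩ := c.exists_map_of_torsionFree hFM hM
  obtain ⟨FN', hFN', eN⟩ := c.exists_map_of_torsion hFN hN
  let M' : HeartCat tB := ⟨Φ.obj (M.obj⟦(1 : ℤ)⟧), hM.2⟩
  let N' : HeartCat tB := ⟨Φ.obj N.obj, hN.2⟩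
  let i : M' ⟶ X := ObjectProperty.homMk (Φ.map u ≫ r.hom)
  let q : X ⟶ N' := ObjectProperty.homMk (r.inv ≫ Φ.map p)
  obtain ⟨hiq, hS⟩ := shortExact_of_triangle i q _
    (distTriang_of_iso (map_triangle_distinguished Φ hT) (Iso.refl _) r.symm (Iso.refl _)
      (by change (Φ.map u ≫ r.hom) ≫ r.inv = 𝟙 _ ≫ Φ.map u; simp)
      (by change (r.inv ≫ Φ.map p) ≫ 𝟙 _ = r.inv ≫ Φ.map p; simp) (by simp; rfl))
  have hi : Mono i := hS.mono_f
  have hq : Epi q := hS.epi_g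
  have hlt : ∀ (j : Fin l) (i : Fin k), PhaseLT (phase b ZB (Φ.obj (QN j).obj))
      (phase b ZB (Φ.obj ((QM i).obj⟦(1 : ℤ)⟧))) := by
    intro j i
    have h0 := mt (isZero_heartCat_iff _).2 (hFN'.semistable j).1
    have h0' := mt (isZero_heartCat_iff _).2 (hFM'.semistable i).1
    refine (phaseLT_iff c.right (hQN j).2 h0 (hQM i).2 h0').2 (c.posCross_iff.2 ?_)
    -- The shift negates the charge and so reverses the comparison: torsion-free lies below torsion
    -- in $\mathcal A$, but its shift lies above torsion in $\mathcal B$.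
    rw [charge_shift, posCross_neg_right]
    exact c.posCross (hQM i) (mt (isZero_heartCat_iff _).2 (hFM.semistable i).1) (hQN j)
      (mt (isZero_heartCat_iff _).2 (hFN.semistable j).1)
  refine ⟨concatenate i q FM' FN', isHNFiltration_iff.2 ⟨_, hFM'.concatenate hS hFN'
    fun i j => hlt j i⟩, fun n => ?_, fun j => ?_⟩
  · obtain ⟨e, he⟩ := eM n
    rw [concatenate_left i q FM' FN' n]
    refine ⟨tB.heart.ι.mapIso (Subobject.underlyingIso ((FM' n).arrow ≫ i)) ≪≫ e, ?_⟩
    have h1 := congrArg tB.heart.ι.map (Subobject.underlyingIso_hom_comp_eq_mk ((FM' n).arrow ≫ i))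
    rw [Functor.map_comp, Functor.map_comp, ← he] at h1
    refine Eq.trans ?_ h1
    change (tB.heart.ι.map (Subobject.underlyingIso _).hom ≫ e.hom) ≫ _ =
      tB.heart.ι.map _ ≫ (e.hom ≫ _) ≫ Φ.map u ≫ r.hom
    simp only [Functor.map_comp, Category.assoc]
  · obtain ⟨e, he⟩ := eN j
    obtain ⟨L, n, x, y, hL, hn₁, hn₂⟩ := exists_triangle_of_hom₃ hT (tA.heart.ι.map (FN j).arrow)
    refine ⟨L, n, x, y, _, hL, hn₁, hn₂, rfl, ?_⟩
    have hL' := map_triangle_distinguished Φ hL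
    have hFj := tB.heart.prop_of_iso e (FN' j : HeartCat tB).property
    let L' : HeartCat tB := ⟨Φ.obj L, heart_middle hL' hM.2 hFj⟩
    let W : HeartCat tB := ⟨Φ.obj (FN j : HeartCat tA).obj, hFj⟩
    let x' : M' ⟶ L' := ObjectProperty.homMk (Φ.map x)
    let y' : L' ⟶ W := ObjectProperty.homMk (Φ.map y)
    let n' : L' ⟶ X := ObjectProperty.homMk (Φ.map n ≫ r.hom)
    obtain ⟨hxy, hS'⟩ := shortExact_of_triangle x' y' _ hL'
    have h₁ : x' ≫ n' = i := tB.heart.ι.map_injective <| by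
      change Φ.map x ≫ Φ.map n ≫ r.hom = Φ.map u ≫ r.hom
      rw [← hn₁, Functor.map_comp, Category.assoc]
    have h₂ : n' ≫ q = y' ≫ (tB.heart.isoMk e.symm : W ≅ (FN' j : HeartCat tB)).hom ≫
        (FN' j).arrow := tB.heart.ι.map_injective <| by
      change (Φ.map n ≫ r.hom) ≫ r.inv ≫ Φ.map p = Φ.map y ≫ e.inv ≫ tB.heart.ι.map (FN' j).arrow
      rw [← he, e.inv_hom_id_assoc, Category.assoc, r.hom_inv_id_assoc, ← Functor.map_comp,
        ← Functor.map_comp, hn₂]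
    -- The base change `L` of the triangle along `FN j` becomes an extension of the image of `FN j`
    -- by `M'` in $\mathcal B$, so it is the preimage of `FN' j` under `q`.
    obtain ⟨e', he'⟩ := exists_iso_pullback hS hS' (FN' j) (Iso.refl _) (tB.heart.isoMk e.symm) n'
      (h₁.trans (Category.id_comp _).symm) h₂
    rw [concatenate_right hS FM' FN' hFM'.last hFN'.zero j]
    refine ⟨tB.heart.ι.mapIso e', ?_⟩
    have h3 := congrArg tB.heart.ι.map he'
    rw [Functor.map_comp] at h3
    exact h3

end Tilted


/-! ### Objects of amplitude `[0, 1]` -/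

section Amplitude

variable {C : Type*} [Category* C] [Preadditive C] [HasZeroObject C] [HasShift C ℤ]
  [∀ n : ℤ, (shiftFunctor C n).Additive] [Pretriangulated C] {t : TStructure C}

theorem nonempty_truncLE_iso_cohomology {Y : C} (hY : t.IsGE Y 0) :
    Nonempty ((t.truncLE 0).obj Y ≅ cohomology t 0 Y) := by
  have h1 : IsIso ((t.truncGEπ 0).app Y) := (t.isGE_iff_isIso_truncGEπ_app 0 Y).1 hY
  exact ⟨(t.truncLE 0).mapIso (asIso ((t.truncGEπ 0).app Y)) ≪≫
    ((shiftFunctorZero C ℤ).app _).symm⟩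

theorem nonempty_truncGE_shift_iso_cohomology {Y : C} (hY : t.IsLE ((t.truncGE 1).obj Y) 1) :
    Nonempty (((t.truncGE 1).obj Y)⟦(1 : ℤ)⟧ ≅ cohomology t 1 Y) := by
  have h1 : IsIso ((t.truncLEι 1).app ((t.truncGE 1).obj Y)) :=
    (t.isLE_iff_isIso_truncLEι_app 1 _).1 hY
  exact ⟨(shiftFunctor C (1 : ℤ)).mapIso
    (asIso ((t.truncLEι 1).app ((t.truncGE 1).obj Y))).symm⟩

/-- An object of amplitude `[0, 1]` is an extension of its two cohomology objects. -/
theorem exists_cohomology_triangle {Y : C} (h0 : t.IsGE Y 0) (h1 : t.IsLE Y 1) :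
    ∃ (M N : HeartCat t) (u : M.obj⟦(1 : ℤ)⟧ ⟶ Y⟦(1 : ℤ)⟧) (p : Y⟦(1 : ℤ)⟧ ⟶ N.obj)
      (w : N.obj ⟶ (M.obj⟦(1 : ℤ)⟧)⟦(1 : ℤ)⟧), Triangle.mk u p w ∈ distTriang C ∧
      Nonempty (M.obj ≅ cohomology t 0 Y) ∧ Nonempty (N.obj ≅ cohomology t 1 Y) := by
  have hT : Triangle.mk _ _ _ ∈ distTriang C := t.triangleLEGE_distinguished 0 1 rfl Y
  have hA : t.IsLE ((t.truncLE 0).obj Y) 0 := inferInstance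
  have hB : t.IsGE ((t.truncGE 1).obj Y) 1 := inferInstance
  have hA' : t.IsGE ((t.truncLE 0).obj Y) 0 := isGE_fibre hT 0 h0 (isGE_mono hB _)
  have hB' : t.IsLE ((t.truncGE 1).obj Y) 1 := isLE_cone hT 1 (isLE_mono hA _) h1
  exact ⟨⟨_, (t.mem_heart_iff _).2 ⟨hA, hA'⟩⟩,
    ⟨((t.truncGE 1).obj Y)⟦(1 : ℤ)⟧,
      (t.mem_heart_iff _).2 ⟨isLE_shift_of hB' 1 0, isGE_shift_of hB 1 0⟩⟩,
    _, _, _, triangle_shift_distinguished hT, nonempty_truncLE_iso_cohomology h0,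
    nonempty_truncGE_shift_iso_cohomology hB'⟩

theorem IsHNFiltration.one_le {a : ℝ → ℝ} {Z : K₀ C →+ CLaurent} {E : HeartCat t} {m : ℕ}
    {F : Fin (m + 1) → Subobject E} (hF : IsHNFiltration t a Z F) (hE : ¬ IsZero E) : 1 ≤ m := by
  obtain ⟨-, h0, h1, -⟩ := hF
  rw [Nat.one_le_iff_ne_zero]
  rintro rfl
  rw [show (0 : Fin (0 + 1)) = Fin.last 0 from rfl, h1] at h0
  exact hE (h0.of_iso (asIso (⊤ : Subobject E).arrow).symm)

variable [IsTriangulated C]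

/-- The HN property concerns nonzero objects only, while either cohomology object of $\Psi X$ may
vanish; the filtration of length zero covers that case. -/
theorem HasHNProperty.exists_isHNFiltration {a : ℝ → ℝ} {Z : K₀ C →+ CLaurent}
    (h : HasHNProperty t a Z) (E : HeartCat t) :
    ∃ (m : ℕ) (F : Fin (m + 1) → Subobject E), IsHNFiltration t a Z F := by
  by_cases hE : IsZero E
  · refine ⟨0, fun _ => ⊤, isHNFiltration_iff.2 ⟨Fin.elim0, ?_, rfl, fun i => i.elim0,
      fun i => i.elim0, fun i => i.elim0⟩⟩
    exact (isZero_subobject_iff _).1 (hE.of_iso (asIso (⊤ : Subobject E).arrow))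
  · obtain ⟨m, -, F, hF⟩ := h E hE
    exact ⟨m, F, hF⟩

end Amplitude

end PolyStab

/-! ### The proposition for Configuration III. -/

theorem proposition5p6
    {D : Type*} [Category* D] [Preadditive D] [HasZeroObject D] [HasShift D ℤ]
    [∀ n : ℤ, (shiftFunctor D n).Additive] [Pretriangulated D] [IsTriangulated D]
    {U : Type*} [Category* U] [Preadditive U] [HasZeroObject U] [HasShift U ℤ]
    [∀ n : ℤ, (shiftFunctor U n).Additive] [Pretriangulated U] [IsTriangulated U]
    -- (a) exact equivalences `Φ`, `Ψ` with `ΨΦ ≅ id[-1]` and `ΦΨ ≅ id[-1]`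
    (Φ : D ⥤ U) [Φ.CommShift ℤ] [Φ.IsTriangulated] [Φ.IsEquivalence]
    (Ψ : U ⥤ D) [Ψ.CommShift ℤ] [Ψ.IsTriangulated] [Ψ.IsEquivalence]
    (α : Φ ⋙ Ψ ≅ shiftFunctor D (-1 : ℤ)) (β : Ψ ⋙ Φ ≅ shiftFunctor U (-1 : ℤ))
    -- (b) bounded t-structures with hearts `A`, `B` such that `ΦA ⊆ D_B^{[0,1]}`
    (tA : TStructure D) (tB : TStructure U) (hA : IsBounded tA) (hB : IsBounded tB)
    (hΦ : ∀ E : HeartCat tA, IsInRange tB 0 1 (Φ.obj E.obj))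
    -- (c) polynomial stability functions on `A`, `B`, related by `T`
    (a b : ℝ → ℝ) (ZA : K₀ D →+ CLaurent) (ZB : K₀ U →+ CLaurent)
    (hZA : IsPolyStabilityFunction tA a ZA) (hZB : IsPolyStabilityFunction tB b ZB)
    (T : GL (Fin 2) RLaurent) (hT : IsOrientationPreserving T)
    (hZ : ∀ E : D, charge ZB (Φ.obj E) = act T (charge ZA E))
    (Γ : LiftedPath T) (ha : PhaseLT a (Γ.GammaInv b))
    (hb : PhaseLT (Γ.GammaInv b) (fun v => a v + 1))
    (hHN : HasHNProperty tA a ZA) :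
    HasHNProperty tB b ZB ∧
    ∀ X : HeartCat tB, ∃ (M N : HeartCat tA)
      (u : M.obj⟦(1 : ℤ)⟧ ⟶ (Ψ.obj X.obj)⟦(1 : ℤ)⟧) (p : (Ψ.obj X.obj)⟦(1 : ℤ)⟧ ⟶ N.obj)
      (w : N.obj ⟶ (M.obj⟦(1 : ℤ)⟧)⟦(1 : ℤ)⟧),
      Triangle.mk u p w ∈ distTriang D ∧
      Nonempty (M.obj ≅ cohomology tA 0 (Ψ.obj X.obj)) ∧
      Nonempty (N.obj ≅ cohomology tA 1 (Ψ.obj X.obj)) ∧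
      ∀ (k l : ℕ) (FM : Fin (k + 1) → Subobject M) (FN : Fin (l + 1) → Subobject N),
        IsHNFiltration tA a ZA FM → IsHNFiltration tA a ZA FN →
        ∃ FX : Fin (k + l + 1) → Subobject X, IsHNFiltration tB b ZB FX ∧
          IsImageOfConcatenation Φ Ψ β tA tB u p w FM FN FX := by
  have c : StabilityTilt Φ tA tB a b ZA ZB Γ :=
    ⟨isTilt_transport Φ hA hB hΦ, hZA, hZB, hT, hZ, ha, hb⟩
  have key : ∀ X : HeartCat tB, ∃ (M N : HeartCat tA)
      (u : M.obj⟦(1 : ℤ)⟧ ⟶ (Ψ.obj X.obj)⟦(1 : ℤ)⟧) (p : (Ψ.obj X.obj)⟦(1 : ℤ)⟧ ⟶ N.obj)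
      (w : N.obj ⟶ (M.obj⟦(1 : ℤ)⟧)⟦(1 : ℤ)⟧),
      Triangle.mk u p w ∈ distTriang D ∧
      Nonempty (M.obj ≅ cohomology tA 0 (Ψ.obj X.obj)) ∧
      Nonempty (N.obj ≅ cohomology tA 1 (Ψ.obj X.obj)) := by
    intro X
    -- From $\Phi(\Psi X[1])\cong X$ it follows that $\Psi X[1]$ lies in the transported heart. It
    -- therefore has `tA`-amplitude $[-1,0]$, and $\Psi X$ has amplitude $[0,1]$.
    have hX := (TStructure.mem_heart_iff _ _).1 ((transport_heart_iff Φ tB _).2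
      (tB.heart.prop_of_iso (reflectIso Φ Ψ β X.obj).symm X.property))
    have h0 := c.tilt.isGE_neg_one hX.2
    have h1 := c.tilt.isLE_zero hX.1
    exact exists_cohomology_triangle (tA.isGE_of_shift _ 0 1 (-1)) (tA.isLE_of_shift _ 1 1 0)
  constructor
  · intro X hX
    obtain ⟨M, N, u, p, w, hT, -, -⟩ := key X
    obtain ⟨k, FM, hFM⟩ := hHN.exists_isHNFiltration M
    obtain ⟨l, FN, hFN⟩ := hHN.exists_isHNFiltration N
    obtain ⟨FX, hFX, -⟩ := c.exists_concatenation (reflectIso Φ Ψ β X.obj) hT hFM hFN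
    exact ⟨k + l, hFX.one_le hX, FX, hFX⟩
  · intro X
    obtain ⟨M, N, u, p, w, hT, hM, hN⟩ := key X
    exact ⟨M, N, u, p, w, hT, hM, hN, fun k l FM FN hFM hFN =>
      c.exists_concatenation (reflectIso Φ Ψ β X.obj) hT hFM hFN⟩
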